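/- **Setting.** There are $m\ge 1$ items and $n\ge 1$ players. Player $i$ has a valuation $v_i:2^{[m]}\to\mathbb R$ that is non-decreasing with $v_i(\emptyset)=0$; it is subadditive if $v_i(S\cup T)\le v_i(S)+v_i(T)$ for all $S,T$. An allocation $(A_1,\dots,A_n)$ consists of pairwise disjoint bundles of items (not all items need be allocated), and its Nash Social Welfare is $\mathrm{NSW}(A)=\big(\prod_i v_i(A_i)\big)^{1/n}$. A mechanism consists of an allocation rule $f$ and fees $p$; in the percentage fee model the profit of player $i$ at reports $v$ is $(1-p_i(v))\,v_i(f(v))$, where $p_i(v)\in[0,1)$, and the mechanism is incentive compatible if reporting the true valuation is a dominant strategy of each player for this profit. It guarantees approximation ratio $\rho$ at $v$ if $\mathrm{NSW}(O)\le\rho\cdot \mathrm{NSW}(f(v))$ for every allocation $O$. **Mechanism.** Assign each item independently and uniformly at random to one of $2n$ bundles $S_1,\dots,S_{2n}$. Let $\mathcal R$ be the set of allocations in which each player gets one of the bundles $S_j$ or a single item outside the bundles allocated to the other players. Choose an allocation of maximum Nash Social Welfare in $\mathcal R$ (ties broken in any way); if this maximum is $0$, allocate nothing. **Theorem.** 1.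 For every realization of the partition there are fees with values in $[0,1)$ that make the mechanism incentive compatible in the percentage fee model, on the domain of all (non-decreasing, normalized) valuations. 2. There are absolute constants $C,C'>0$ such that for all $n,m\geq 1$ and all subadditive valuations, with probability at least $1-1/m$ over the random partition the mechanism guarantees the approximation ratio $\min\left(\frac mn,\;C\,n\log^2 m\right)$; moreover $\min\left(\frac mn,\;C\,n\log^2 m\right)\le C'\,m^{1/2}\log m$. 3. The mechanism has an implementation, for all (non-decreasing, normalized) valuations: there is one program for a random access machine with value oracles which, for all $n,m\ge1$, given $n$, $m$ and the random bundle indices of the $m$ items, computes the allocation chosen by such a mechanism together with fees in $[0,1)$ that make it incentive compatible, makes $O(m+n)$ value queries to each player, and runs in time $2^{O(n)}\mathrm{poly}(m)$. Here time is the number of steps, where real arithmetic operations ($+,-,\times,\div$) and comparisons, addition, subtraction, halving and comparison of natural numbers, array accesses and value queries take unit time. -/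

import Mathlib

open MeasureTheory

namespace NashMIR

/-! ### Combinatorial auctions and the Nash Social Welfare -/

/-- A valuation on bundles of `m` items: non-decreasing, with value `0` on the empty bundle
(hence non-negative). -/
structure ItemValuation (m : ℕ) where
  val : Finset (Fin m) → ℝ
  mono : ∀ S T : Finset (Fin m), S ⊆ T → val S ≤ val T
  empty : val ∅ = 0

/-- A valuation profile of `n` players. -/
abbrev Profile (n m : ℕ) := Fin n → ItemValuation m

/-- An assignment of a bundle to every player. -/
abbrev Assignment (n m : ℕ) := Fin n → Finset (Fin m)

def ItemValuation.Subadditive {m : ℕ} (v : ItemValuation m) : Prop :=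
  ∀ S T : Finset (Fin m), v.val (S ∪ T) ≤ v.val S + v.val T

/-- An allocation gives pairwise disjoint bundles to the players (items may stay unallocated). -/
def IsAllocation {n m : ℕ} (A : Assignment n m) : Prop :=
  ∀ i j : Fin n, i ≠ j → Disjoint (A i) (A j)

/-- The Nash Social Welfare: the geometric mean of the values of the players. -/
noncomputable def nsw {n m : ℕ} (v : Profile n m) (A : Assignment n m) : ℝ :=
  (∏ i, (v i).val (A i)) ^ (1 / (n : ℝ))

/-- `A` is a `ρ`-approximation: the Nash Social Welfare of every allocation (so also the optimal
one) is at most `ρ` times that of `A`. -/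
def ApproximatesNSW {n m : ℕ} (ρ : ℝ) (v : Profile n m) (A : Assignment n m) : Prop :=
  ∀ O : Assignment n m, IsAllocation O → nsw v O ≤ ρ * nsw v A

/-! ### Mechanisms in the percentage fee model -/

/-- Incentive compatibility in the percentage fee model of the social choice function `f` with
the fees `p`: fees are in `[0, 1)`, and truthful reporting is a dominant strategy for the profit
`(1 - pᵢ) · vᵢ`. -/
def IsIncentiveCompatible {n m : ℕ} (f : Profile n m → Assignment n m)
    (p : Profile n m → Fin n → ℝ) : Prop :=
  (∀ v i, 0 ≤ p v i ∧ p v i < 1) ∧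
  ∀ (v : Profile n m) (i : Fin n) (w : ItemValuation m),
    (1 - p (Function.update v i w) i) * (v i).val (f (Function.update v i w) i) ≤
      (1 - p v i) * (v i).val (f v i)

/-- `f` is a maximal-in-range social choice function for the range `R`: it selects an allocation
of maximum Nash Social Welfare in `R` (ties broken in any way), and the null allocation if that
maximum is `0`. -/
def IsMaximalInRange {n m : ℕ} (R : Set (Assignment n m))
    (f : Profile n m → Assignment n m) : Prop :=
  ∀ v : Profile n m,
    ((∃ A ∈ R, 0 < nsw v A) → f v ∈ R ∧ ∀ A ∈ R, nsw v A ≤ nsw v (f v)) ∧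
    ((¬ ∃ A ∈ R, 0 < nsw v A) → f v = fun _ => ∅)

/-- The `k`-th of the `2n` bundles of the partition in which item `j` goes to bundle `π j`. -/
def bundle {n m : ℕ} (π : Fin m → Fin (2 * n)) (k : Fin (2 * n)) : Finset (Fin m) :=
  Finset.univ.filter fun j => π j = k

/-- The allocations in which every player gets one of the bundles or a single item (outside what
the other players get, since the parts of an allocation are disjoint). -/
def bundleRange {n m : ℕ} (π : Fin m → Fin (2 * n)) : Set (Assignment n m) :=
  {A | IsAllocation A ∧ ∀ i, (∃ k, A i = bundle π k) ∨ ∃ j, A i = {j}}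

/-- The law of the random partition: each item goes to a uniformly random bundle, independently
of the other items. -/
noncomputable def partitionLaw (n m : ℕ) : Measure (Fin m → Fin (2 * n)) :=
  Measure.pi fun _ => ProbabilityTheory.uniformOn Set.univ

/-! ### A random access machine with real arithmetic and value queries

Programs are finite texts that do not depend on the numbers of players and items. The memory
consists of arrays of natural numbers and arrays of real numbers. An array has a name that is fixed
in the program and two indices that are computed at run time. Natural numbers may be added,
subtracted and halved (not multiplied, so that their length grows by a bounded number of bits
per step); real numbers may be added, subtracted, multiplied, divided and compared. -/

structure State where
  nat : ℕ → ℕ → ℕ → ℕ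
  real : ℕ → ℕ → ℕ → ℝ

def State.setNat (s : State) (a i j x : ℕ) : State :=
  { s with nat := fun a' i' j' => if a' = a ∧ i' = i ∧ j' = j then x else s.nat a' i' j' }

noncomputable def State.setReal (s : State) (a i j : ℕ) (x : ℝ) : State :=
  { s with real := fun a' i' j' => if a' = a ∧ i' = i ∧ j' = j then x else s.real a' i' j' }

/-- Expressions for natural numbers; `sub` is truncated and `half` rounds down. -/
inductive NExp where
  | lit (k : ℕ)
  | get (a : ℕ) (i j : NExp)
  | add (x y : NExp)
  | sub (x y : NExp)
  | half (x : NExp)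

def NExp.eval (s : State) : NExp → ℕ
  | .lit k => k
  | .get a i j => s.nat a (i.eval s) (j.eval s)
  | .add x y => x.eval s + y.eval s
  | .sub x y => x.eval s - y.eval s
  | .half x => x.eval s / 2

/-- Expressions for real numbers; the only constants are `0` and `1`. -/
inductive RExp where
  | zero
  | one
  | get (a : ℕ) (i j : NExp)
  | add (x y : RExp)
  | sub (x y : RExp)
  | mul (x y : RExp)
  | div (x y : RExp)

noncomputable def RExp.eval (s : State) : RExp → ℝ
  | .zero => 0
  | .one => 1
  | .get a i j => s.real a (i.eval s) (j.eval s)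
  | .add x y => x.eval s + y.eval s
  | .sub x y => x.eval s - y.eval s
  | .mul x y => x.eval s * y.eval s
  | .div x y => x.eval s / y.eval s

/-- Tests. -/
inductive BExp where
  | natLe (x y : NExp)
  | realLe (x y : RExp)
  | not (b : BExp)
  | and (b c : BExp)

def BExp.eval (s : State) : BExp → Prop
  | .natLe x y => x.eval s ≤ y.eval s
  | .realLe x y => x.eval s ≤ y.eval s
  | .not b => ¬ b.eval s
  | .and b c => b.eval s ∧ c.eval s

/-- Programs. The arguments `a i j` of an assignment or of a query name the array cell that
receives the result. -/
inductive Prog where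
  | skip
  | setNat (a : ℕ) (i j x : NExp)
  | setReal (a : ℕ) (i j : NExp) (x : RExp)
  | query (a : ℕ) (i j : NExp) (player : NExp) (b : ℕ) (row : NExp)
  | seq (c d : Prog)
  | ite (b : BExp) (c d : Prog)
  | while (b : BExp) (c : Prog)

/-- The bundle written in row `r` of the natural number array `b`: item `x` belongs to it if and
only if the entry in position `x` is not `0`. -/
def State.readBundle (s : State) (m b r : ℕ) : Finset (Fin m) :=
  Finset.univ.filter fun x => s.nat b r x ≠ 0

/-- `Exec v c s s' t q`: with value oracles for the profile `v`, the program `c` started in the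
state `s` halts in the state `s'` after `t` steps, having made `q i` value queries to player `i`.
Each assignment, query and test takes one step (up to a constant factor that depends
on the program only, this is the number of elementary operations). -/
inductive Exec {n m : ℕ} (v : Profile n m) :
    Prog → State → State → ℕ → (Fin n → ℕ) → Prop where
  | skip (s : State) : Exec v .skip s s 1 0
  | setNat (s : State) (a : ℕ) (i j x : NExp) :
      Exec v (.setNat a i j x) s (s.setNat a (i.eval s) (j.eval s) (x.eval s)) 1 0
  | setReal (s : State) (a : ℕ) (i j : NExp) (x : RExp) :
      Exec v (.setReal a i j x) s (s.setReal a (i.eval s) (j.eval s) (x.eval s)) 1 0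
  | query (s : State) (a : ℕ) (i j player : NExp) (b : ℕ) (row : NExp) (k : Fin n)
      (hk : player.eval s = k) :
      Exec v (.query a i j player b row) s
        (s.setReal a (i.eval s) (j.eval s) ((v k).val (s.readBundle m b (row.eval s))))
        1 (Pi.single k 1)
  | seq {c d : Prog} {s s' s'' : State} {t t' : ℕ} {q q' : Fin n → ℕ}
      (h : Exec v c s s' t q) (h' : Exec v d s' s'' t' q') :
      Exec v (.seq c d) s s'' (t + t') (q + q')
  | iteTrue {b : BExp} {c d : Prog} {s s' : State} {t : ℕ} {q : Fin n → ℕ}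
      (hb : b.eval s) (h : Exec v c s s' t q) : Exec v (.ite b c d) s s' (t + 1) q
  | iteFalse {b : BExp} {c d : Prog} {s s' : State} {t : ℕ} {q : Fin n → ℕ}
      (hb : ¬ b.eval s) (h : Exec v d s s' t q) : Exec v (.ite b c d) s s' (t + 1) q
  | whileFalse {b : BExp} {c : Prog} {s : State} (hb : ¬ b.eval s) :
      Exec v (.while b c) s s 1 0
  | whileTrue {b : BExp} {c : Prog} {s s' s'' : State} {t t' : ℕ} {q q' : Fin n → ℕ}
      (hb : b.eval s) (h : Exec v c s s' t q) (h' : Exec v (.while b c) s' s'' t' q') :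
      Exec v (.while b c) s s'' (t + t' + 1) (q + q')

/-- The initial state: the natural number arrays `0` and `1` hold `n` and `m` in position `(0, 0)`,
row `0` of array `2` holds the `m` random numbers `π j < 2n`; everything else is `0`. -/
def initState {n m : ℕ} (π : Fin m → Fin (2 * n)) : State where
  nat a i j :=
    if a = 0 ∧ i = 0 ∧ j = 0 then n
    else if a = 1 ∧ i = 0 ∧ j = 0 then m
    else if h : a = 2 ∧ i = 0 ∧ j < m then (π ⟨j, h.2.2⟩ : ℕ)
    else 0
  real _ _ _ := 0

/-- The allocation in a final state: row `i` of the natural number array `3` is the bundle of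
player `i`. -/
def State.outAssignment (s : State) (n m : ℕ) : Assignment n m := fun i => s.readBundle m 3 i

/-- The fees in a final state: position `(i, 0)` of the real array `0` is the fee of player `i`. -/
def State.outFee (s : State) (n : ℕ) : Fin n → ℝ := fun i => s.real 0 i 0

end NashMIR

open NashMIR

/-!
Throughout, `∏ᵢ vᵢ(Aᵢ)` replaces the Nash Social Welfare, which is a monotone function of it.

*Incentives.* With the fees `fee`, the profit of player `i` is `∏ₖ vₖ(Aₖ)` at the true valuation of
`i`, divided by the product of the values of the other players for all items. The divisor is out of
the control of `i`, and a mechanism that maximizes the product over a fixed range maximizes this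
profit (`isIncentiveCompatible_fee`).

*Approximation.* The ratio `m / n` holds for every partition: by subadditivity player `i` loses at
most a factor `|Oᵢ|` when getting the best item of an optimal bundle `Oᵢ` instead of `Oᵢ`, and
`∏ |Oᵢ| ≤ (m / n) ^ n` (`exists_items_prod_le`). For the ratio `ρ = 64 n log² m`, players with an item
worth `vᵢ(Oᵢ) / ρ` in `Oᵢ` get such an item, and at least `n` of the `2n` bundles avoid these items and
serve the other players (`exists_mem_bundleRange_prod_le`). This works if all bundles are worth
`vᵢ(Oᵢ) / ρ` to all the other players. A subadditive valuation has additive prices that cover the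
value of `Oᵢ` and exceed the value of any part of it by at most a harmonic number
(`exists_price`). For a player without valuable items each price is small, so by a
Chernoff bound (`card_small_share_le`) a bundle rarely gets less than a quarter of its expected share
of the prices.

*Implementation.* For every set of bundles reserved for use as bundles, a dynamic program over sets
of players finds the best matching of the players to the objects that are the reserved bundles and
the single items outside of them. Since the objects are taken one at a time, a matching that uses the
last object `t` for player `i` is a matching of the set without `i` to earlier objects
(`PartialEntry`). Allocations of positive welfare in the range are such matchings
(`exists_feasible_of_mem_bundleRange`, `mem_bundleRange_of_feasible`). Programs are verified with total
correctness rules that bound steps and queries (`Runs`); what a program leaves unchanged is read off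
its text (`Exec.agree`).
-/

namespace NashMIR

/-! ### The welfare product -/

lemma ItemValuation.nonneg {m : ℕ} (v : ItemValuation m) (S : Finset (Fin m)) : 0 ≤ v.val S := by
  simpa [v.empty] using v.mono ∅ S (Finset.empty_subset S)

lemma prod_val_nonneg {n m : ℕ} (v : Profile n m) (A : Assignment n m) :
    0 ≤ ∏ i, (v i).val (A i) :=
  Finset.prod_nonneg fun i _ => (v i).nonneg _

lemma nsw_le_nsw_iff {n m : ℕ} (hn : 1 ≤ n) (v : Profile n m) (A B : Assignment n m) :
    nsw v A ≤ nsw v B ↔ ∏ i, (v i).val (A i) ≤ ∏ i, (v i).val (B i) :=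
  Real.rpow_le_rpow_iff (prod_val_nonneg v A) (prod_val_nonneg v B) (by positivity)

lemma nsw_pos_iff {n m : ℕ} (hn : 1 ≤ n) (v : Profile n m) (A : Assignment n m) :
    0 < nsw v A ↔ 0 < ∏ i, (v i).val (A i) := by
  have hn' : (1 / (n : ℝ)) ≠ 0 := by positivity
  rw [nsw]
  constructor
  · intro h
    refine lt_of_le_of_ne (prod_val_nonneg v A) fun h0 => ?_
    rw [← h0, Real.zero_rpow hn'] at h
    exact lt_irrefl _ h
  · exact fun h => Real.rpow_pos_of_pos h _

/-! ### Fees -/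

open Classical in
/-- The percentage fee of player `i` at the allocation `A`: the profit it leaves is the product
of all values at `A` divided by the product of the values of the others for all items. The divisor
does not depend on the report of `i` and is at least the product of the values of the others at
`A`, which puts the fee in `[0, 1)`. If the welfare of `A` is `0`, the fee is `0`. -/
noncomputable def fee {n m : ℕ} (v : Profile n m) (A : Assignment n m) (i : Fin n) : ℝ :=
  if 0 < ∏ k, (v k).val (A k) then
    1 - (∏ k ∈ Finset.univ.erase i, (v k).val (A k)) /
      ∏ k ∈ Finset.univ.erase i, (v k).val Finset.univ
  else 0

/-- The factor left to player `i` by the fee lies in `(0, 1]`. -/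
lemma keep_mem_Ioc {n m : ℕ} {v : Profile n m} {A : Assignment n m}
    (h : 0 < ∏ k, (v k).val (A k)) (i : Fin n) :
    0 < (∏ k ∈ Finset.univ.erase i, (v k).val (A k)) /
      ∏ k ∈ Finset.univ.erase i, (v k).val Finset.univ ∧
    (∏ k ∈ Finset.univ.erase i, (v k).val (A k)) /
      ∏ k ∈ Finset.univ.erase i, (v k).val Finset.univ ≤ 1 := by
  have hpos : ∀ k, 0 < (v k).val (A k) := fun k =>
    lt_of_le_of_ne ((v k).nonneg _) fun h0 => h.ne' (Finset.prod_eq_zero (Finset.mem_univ k) h0.symm)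
  have hle : ∀ k, (v k).val (A k) ≤ (v k).val Finset.univ := fun k =>
    (v k).mono _ _ (Finset.subset_univ _)
  have hP : 0 < ∏ k ∈ Finset.univ.erase i, (v k).val Finset.univ :=
    Finset.prod_pos fun k _ => (hpos k).trans_le (hle k)
  exact ⟨div_pos (Finset.prod_pos fun k _ => hpos k) hP,
    (div_le_one hP).2 (Finset.prod_le_prod (fun k _ => (hpos k).le) fun k _ => hle k)⟩

lemma fee_nonneg_lt_one {n m : ℕ} (v : Profile n m) (A : Assignment n m) (i : Fin n) :
    0 ≤ fee v A i ∧ fee v A i < 1 := by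
  unfold fee
  split_ifs with h
  · obtain ⟨h1, h2⟩ := keep_mem_Ioc h i
    constructor <;> linarith
  · simp

/-- The profit of a player with valuation `x` under the fees `fee`. -/
lemma one_sub_fee_mul {n m : ℕ} {v : Profile n m} {A : Assignment n m}
    (h : 0 < ∏ k, (v k).val (A k)) (i : Fin n) (x : ItemValuation m) :
    (1 - fee v A i) * x.val (A i) =
      (∏ k, (Function.update v i x k).val (A k)) /
        ∏ k ∈ Finset.univ.erase i, (v k).val Finset.univ := by
  have e : ∏ k, (Function.update v i x k).val (A k) =
      x.val (A i) * ∏ k ∈ Finset.univ.erase i, (v k).val (A k) := by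
    rw [← Finset.mul_prod_erase _ _ (Finset.mem_univ i), Function.update_self]
    congr 1
    refine Finset.prod_congr rfl fun k hk => ?_
    rw [Function.update_of_ne (Finset.ne_of_mem_erase hk)]
  rw [e, fee, if_pos h]
  ring

/-- Maximal-in-range mechanisms are incentive compatible with the fees `fee`: they charge so that
the profit of a player is the product of all values up to a factor out of that player's control. -/
theorem isIncentiveCompatible_fee {n m : ℕ} (hn : 1 ≤ n) {R : Set (Assignment n m)}
    {f : Profile n m → Assignment n m} (hf : IsMaximalInRange R f) :
    IsIncentiveCompatible f fun v => fee v (f v) := by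
  refine ⟨fun v i => fee_nonneg_lt_one v (f v) i, fun v i w => ?_⟩
  set v' := Function.update v i w with hv'
  have hR : 0 ≤ (1 - fee v (f v) i) * (v i).val (f v i) :=
    mul_nonneg (by linarith [(fee_nonneg_lt_one v (f v) i).2]) ((v i).nonneg _)
  by_cases hex' : ∃ A ∈ R, 0 < nsw v' A
  swap
  · rw [(hf v').2 hex']
    simpa [(v i).empty] using hR
  obtain ⟨hm', hmax'⟩ := (hf v').1 hex'
  have hpos' : 0 < ∏ k, (v' k).val (f v' k) := by
    obtain ⟨A, hA, hA0⟩ := hex'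
    exact (nsw_pos_iff hn _ _).1 (hA0.trans_le (hmax' A hA))
  have hback : Function.update v' i (v i) = v := by simp [hv']
  have hden : ∏ k ∈ Finset.univ.erase i, (v' k).val Finset.univ =
      ∏ k ∈ Finset.univ.erase i, (v k).val Finset.univ :=
    Finset.prod_congr rfl fun k hk => by
      rw [hv', Function.update_of_ne (Finset.ne_of_mem_erase hk)]
  rw [one_sub_fee_mul hpos' i (v i), hback, hden]
  by_cases hex : ∃ A ∈ R, 0 < nsw v A
  · obtain ⟨hm, hmax⟩ := (hf v).1 hex
    have hpos : 0 < ∏ k, (v k).val (f v k) := by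
      obtain ⟨A, hA, hA0⟩ := hex
      exact (nsw_pos_iff hn _ _).1 (hA0.trans_le (hmax A hA))
    rw [one_sub_fee_mul hpos i (v i), Function.update_eq_self]
    exact div_le_div_of_nonneg_right ((nsw_le_nsw_iff hn v _ _).1 (hmax _ hm'))
      (Finset.prod_nonneg fun k _ => (v k).nonneg _)
  · have h0 : ∏ k, (v k).val (f v' k) = 0 := by
      refine le_antisymm (not_lt.1 fun h => hex ⟨_, hm', (nsw_pos_iff hn _ _).2 h⟩)
        (prod_val_nonneg v _)
    rw [h0, zero_div]
    exact hR

/-! ### Additive prices for subadditive valuations -/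

lemma div_add_harmonic_le (a b c : ℕ) (h : b + a ≤ c) :
    (a : ℝ) / c + (harmonic b : ℝ) ≤ (harmonic (b + a) : ℝ) := by
  induction a with
  | zero => simp
  | succ a ih =>
    have hs : ((harmonic (b + (a + 1)) : ℚ) : ℝ) = harmonic (b + a) + 1 / ((b + a + 1 : ℕ) : ℝ) := by
      rw [← add_assoc, harmonic_succ]
      push_cast
      ring
    have h1 : (1 : ℝ) / (c : ℝ) ≤ 1 / ((b + a + 1 : ℕ) : ℝ) :=
      one_div_le_one_div_of_le (by positivity) (by exact_mod_cast (by omega : b + a + 1 ≤ c))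
    have h2 := ih (by omega)
    rw [hs]
    push_cast at h1 ⊢
    rw [add_div]
    linarith

/-- Greedy pricing: charge the bundle `S ⊆ O` of least value per item that value per item, and
continue with `O \ S`. The prices cover the value of `O`, and they overcharge a bundle by at most a
harmonic number, since each greedy bundle is at least as cheap per item as what is left of `T`. -/
theorem ItemValuation.Subadditive.exists_price {m : ℕ} {v : ItemValuation m} (hv : v.Subadditive)
    (O : Finset (Fin m)) :
    ∃ p : Fin m → ℝ, (∀ j, 0 ≤ p j) ∧ v.val O ≤ ∑ j ∈ O, p j ∧
      ∀ T ⊆ O, ∑ j ∈ T, p j ≤ (harmonic T.card : ℝ) * v.val T := by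
  induction O using Finset.strongInduction with
  | H O ih =>
    rcases O.eq_empty_or_nonempty with rfl | hO
    · refine ⟨0, by simp, by simp [v.empty], fun T hT => ?_⟩
      simp [Finset.subset_empty.1 hT, v.empty]
    obtain ⟨S, hS, hmin⟩ := Finset.exists_min_image (O.powerset.erase ∅)
      (fun S => v.val S / S.card)
      ⟨O, Finset.mem_erase.2 ⟨hO.ne_empty, Finset.mem_powerset_self O⟩⟩
    rw [Finset.mem_erase, Finset.mem_powerset] at hS
    obtain ⟨hS0, hSO⟩ := hS
    have hSne : S.Nonempty := Finset.nonempty_iff_ne_empty.2 hS0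
    obtain ⟨p, hp0, hpO, hpT⟩ := ih (O \ S) (Finset.sdiff_ssubset hSO hSne)
    have hcard : (0 : ℝ) < S.card := by exact_mod_cast hSne.card_pos
    have split : ∀ T : Finset (Fin m),
        ∑ j ∈ T, (if j ∈ S then v.val S / S.card else p j) =
          (T ∩ S).card * (v.val S / S.card) + ∑ j ∈ T \ S, p j := by
      intro T
      rw [← Finset.sum_inter_add_sum_sdiff T S]
      congr 1
      · rw [Finset.sum_congr rfl fun j hj => if_pos (Finset.mem_inter.1 hj).2]
        simp
      · exact Finset.sum_congr rfl fun j hj => if_neg (Finset.mem_sdiff.1 hj).2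
    refine ⟨fun j => if j ∈ S then v.val S / S.card else p j, fun j => ?_, ?_, fun T hT => ?_⟩
    · dsimp only
      split_ifs
      · exact div_nonneg (v.nonneg S) hcard.le
      · exact hp0 j
    · rw [split, Finset.inter_eq_right.2 hSO, mul_div_cancel₀ _ hcard.ne']
      have := hv S (O \ S)
      rw [Finset.union_sdiff_of_subset hSO] at this
      linarith
    · rw [split]
      rcases T.eq_empty_or_nonempty with rfl | hTne
      · simp [v.empty]
      have hTc : (0 : ℝ) < T.card := by exact_mod_cast hTne.card_pos
      have h1 := hmin T (Finset.mem_erase.2 ⟨hTne.ne_empty, Finset.mem_powerset.2 hT⟩)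
      have h2 := hpT (T \ S) (Finset.sdiff_subset_sdiff hT le_rfl)
      have hH : (0 : ℝ) ≤ harmonic (T \ S).card := by
        have : (0 : ℚ) ≤ harmonic (T \ S).card := Finset.sum_nonneg fun i _ => by positivity
        exact_mod_cast this
      have h3 : (harmonic (T \ S).card : ℝ) * v.val (T \ S) ≤ harmonic (T \ S).card * v.val T :=
        mul_le_mul_of_nonneg_left (v.mono _ _ Finset.sdiff_subset) hH
      have h4 : ((T ∩ S).card : ℝ) * (v.val S / S.card) ≤ (T ∩ S).card * (v.val T / T.card) :=
        mul_le_mul_of_nonneg_left h1 (by positivity)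
      have hc : (T \ S).card + (T ∩ S).card = T.card := Finset.card_sdiff_add_card_inter T S
      have h5 := div_add_harmonic_le (T ∩ S).card (T \ S).card T.card hc.le
      rw [hc] at h5
      have h6 := mul_le_mul_of_nonneg_right h5 (v.nonneg T)
      calc _ ≤ ((T ∩ S).card : ℝ) * (v.val T / T.card) + harmonic (T \ S).card * v.val T := by
              linarith
        _ = (((T ∩ S).card : ℝ) / T.card + harmonic (T \ S).card) * v.val T := by ring
        _ ≤ _ := h6

lemma ItemValuation.Subadditive.le_sum_singleton {m : ℕ} {v : ItemValuation m}
    (hv : v.Subadditive) (S : Finset (Fin m)) : v.val S ≤ ∑ j ∈ S, v.val {j} := by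
  induction S using Finset.induction_on with
  | empty => simp [v.empty]
  | insert j S hj ih =>
    rw [Finset.sum_insert hj, Finset.insert_eq]
    exact (hv _ _).trans (by linarith)

/-! ### Concentration of additive prices on a random bundle -/

lemma exp_neg_le_one_sub_half {x : ℝ} (h0 : 0 ≤ x) (h1 : x ≤ 1) : Real.exp (-x) ≤ 1 - x / 2 := by
  have hx : 0 < 1 + x := by linarith
  rw [Real.exp_neg]
  calc (Real.exp x)⁻¹ ≤ (1 + x)⁻¹ := inv_anti₀ hx (by linarith [Real.add_one_le_exp x])
    _ ≤ 1 - x / 2 := by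
      rw [inv_le_iff_one_le_mul₀ hx]
      nlinarith

/-- A Chernoff bound: among all maps of the items to `N` bundles, those where a given bundle gets
at most a quarter of its expected share `(∑ x) / N` are exponentially rare. -/
theorem card_small_share_le {m N : ℕ} (hN : 0 < N) (x : Fin m → ℝ) (h0 : ∀ j, 0 ≤ x j)
    (h1 : ∀ j, x j ≤ 1) (k : Fin N) :
    ((Finset.univ.filter fun π : Fin m → Fin N =>
        (∑ j, if π j = k then x j else 0) ≤ (∑ j, x j) / (4 * N)).card : ℝ) ≤
      N ^ m * Real.exp (-((∑ j, x j) / (4 * N))) := by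
  have hN' : (0 : ℝ) < N := by exact_mod_cast hN
  set X := ∑ j, x j
  have hmgf : ∑ π : Fin m → Fin N, Real.exp (-∑ j, if π j = k then x j else 0) ≤
      N ^ m * Real.exp (-(X / (2 * N))) := by
    have hfac : ∀ j, ∑ l : Fin N, Real.exp (-if l = k then x j else 0) ≤
        N * Real.exp (-(x j / (2 * N))) := by
      intro j
      rw [← Finset.add_sum_erase _ _ (Finset.mem_univ k), if_pos rfl,
        Finset.sum_congr rfl fun l hl => by rw [if_neg (Finset.ne_of_mem_erase hl)]]
      have e1 : ((Finset.univ.erase k).card : ℝ) = N - 1 := by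
        rw [Finset.card_erase_of_mem (Finset.mem_univ k), Finset.card_univ, Fintype.card_fin,
          Nat.cast_sub hN, Nat.cast_one]
      have e2 := exp_neg_le_one_sub_half (h0 j) (h1 j)
      have e3 := Real.add_one_le_exp (-(x j / (2 * N)))
      calc _ = Real.exp (-x j) + (N - 1) := by rw [Finset.sum_const, nsmul_eq_mul, e1]; simp
        _ ≤ N * (-(x j / (2 * N)) + 1) := by
          have : (N : ℝ) * (-(x j / (2 * N)) + 1) = N - x j / 2 := by field_simp; ring
          linarith
        _ ≤ _ := mul_le_mul_of_nonneg_left e3 hN'.le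
    calc ∑ π : Fin m → Fin N, Real.exp (-∑ j, if π j = k then x j else 0)
        = ∑ π : Fin m → Fin N, ∏ j, Real.exp (-if π j = k then x j else 0) := by
          refine Finset.sum_congr rfl fun π _ => ?_
          rw [← Finset.sum_neg_distrib, Real.exp_sum]
      _ = ∏ j, ∑ l : Fin N, Real.exp (-if l = k then x j else 0) := by
          rw [Finset.prod_univ_sum, Fintype.piFinset_univ]
      _ ≤ ∏ j, N * Real.exp (-(x j / (2 * N))) :=
          Finset.prod_le_prod (fun j _ => Finset.sum_nonneg fun l _ => (Real.exp_pos _).le)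
            fun j _ => hfac j
      _ = N ^ m * Real.exp (-(X / (2 * N))) := by
          rw [Finset.prod_mul_distrib, ← Real.exp_sum, Finset.sum_neg_distrib, ← Finset.sum_div]
          simp [X]
  set bad := Finset.univ.filter fun π : Fin m → Fin N =>
        (∑ j, if π j = k then x j else 0) ≤ X / (4 * N)
  have hmarkov : bad.card * Real.exp (-(X / (4 * N))) ≤
      ∑ π : Fin m → Fin N, Real.exp (-∑ j, if π j = k then x j else 0) := by
    rw [← nsmul_eq_mul]
    refine (Finset.card_nsmul_le_sum bad _ _ fun π hπ => ?_).trans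
      (Finset.sum_le_sum_of_subset_of_nonneg (Finset.subset_univ _) fun _ _ _ => (Real.exp_pos _).le)
    exact Real.exp_le_exp.2 (neg_le_neg (Finset.mem_filter.1 hπ).2)
  have hsq : Real.exp (-(X / (2 * N))) = Real.exp (-(X / (4 * N))) * Real.exp (-(X / (4 * N))) := by
    rw [← Real.exp_add]
    congr 1
    field_simp
    ring
  have := hmarkov.trans hmgf
  rw [hsq, ← mul_assoc] at this
  exact le_of_mul_le_mul_right this (Real.exp_pos _)

/-- The random partition is uniform on all maps of the items to the bundles. -/
lemma partitionLaw_real {n : ℕ} (m : ℕ) (hn : 1 ≤ n) (s : Finset (Fin m → Fin (2 * n))) :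
    (partitionLaw n m).real (s : Set (Fin m → Fin (2 * n))) = s.card / ((2 * n : ℕ) : ℝ) ^ m := by
  have : Nonempty (Fin (2 * n)) := ⟨⟨0, by omega⟩⟩
  have : IsProbabilityMeasure
      (ProbabilityTheory.uniformOn (Set.univ : Set (Fin (2 * n)))) :=
    ProbabilityTheory.isProbabilityMeasure_uniformOn Set.finite_univ Set.univ_nonempty
  have : IsProbabilityMeasure (partitionLaw n m) := by unfold partitionLaw; infer_instance
  have h1 : ∀ π : Fin m → Fin (2 * n),
      (partitionLaw n m).real {π} = (1 / ((2 * n : ℕ) : ℝ)) ^ m := by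
    intro π
    rw [partitionLaw, measureReal_def, Measure.pi_singleton]
    simp [ProbabilityTheory.uniformOn_univ, ENNReal.toReal_mul]
  rw [← sum_measureReal_singleton s, Finset.sum_congr rfl fun π _ => h1 π]
  rw [Finset.sum_const, nsmul_eq_mul, one_div, inv_pow, div_eq_mul_inv]

/-! ### The approximation ratio -/

lemma approximatesNSW_of_prod_le {n m : ℕ} (hn : 1 ≤ n) {v : Profile n m}
    {R : Set (Assignment n m)} {f : Profile n m → Assignment n m} (hf : IsMaximalInRange R f)
    {ρ : ℝ} (hρ : 0 ≤ ρ) {O A : Assignment n m} (hA : A ∈ R)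
    (h : ∏ i, (v i).val (O i) ≤ ρ ^ n * ∏ i, (v i).val (A i)) :
    nsw v O ≤ ρ * nsw v (f v) := by
  have hn' : (n : ℝ) ≠ 0 := by positivity
  have h1 : nsw v O ≤ ρ * nsw v A := by
    have e : ρ * nsw v A = (ρ ^ n * ∏ i, (v i).val (A i)) ^ (1 / (n : ℝ)) := by
      rw [Real.mul_rpow (by positivity) (prod_val_nonneg v A), ← Real.rpow_natCast,
        ← Real.rpow_mul hρ, mul_one_div_cancel hn', Real.rpow_one, nsw]
    rw [e]
    exact Real.rpow_le_rpow (prod_val_nonneg v O) h (by positivity)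
  refine h1.trans (mul_le_mul_of_nonneg_left ?_ hρ)
  by_cases hex : ∃ A ∈ R, 0 < nsw v A
  · exact ((hf v).1 hex).2 A hA
  · exact (not_lt.1 fun h => hex ⟨A, hA, h⟩).trans (Real.rpow_nonneg (prod_val_nonneg v _) _)

/-- Subadditivity bounds the value of a bundle by its size times the value of its best item. -/
lemma ItemValuation.Subadditive.exists_item {m : ℕ} {v : ItemValuation m} (hv : v.Subadditive)
    {S : Finset (Fin m)} (hS : S.Nonempty) : ∃ j ∈ S, v.val S ≤ S.card * v.val {j} := by
  obtain ⟨j, hj, hmax⟩ := Finset.exists_max_image S (fun j => v.val {j}) hS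
  refine ⟨j, hj, (hv.le_sum_singleton S).trans ?_⟩
  rw [← nsmul_eq_mul]
  exact Finset.sum_le_card_nsmul _ _ _ hmax

/-- By the inequality of arithmetic and geometric means. -/
lemma prod_card_le {n m : ℕ} (hn : 1 ≤ n) {O : Assignment n m} (hO : IsAllocation O) :
    ∏ i, ((O i).card : ℝ) ≤ ((m : ℝ) / n) ^ n := by
  have hn' : (0 : ℝ) < n := by positivity
  have hsum : ∑ i, ((O i).card : ℝ) ≤ m := by
    have h : (Finset.univ.biUnion O).card = ∑ i, (O i).card :=
      Finset.card_biUnion fun i _ j _ hij => hO i j hij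
    have h' : (Finset.univ.biUnion O).card ≤ m := by
      simpa using Finset.card_le_univ (Finset.univ.biUnion O)
    rw [h] at h'
    exact_mod_cast h'
  have hp : (0 : ℝ) ≤ ∏ i, ((O i).card : ℝ) := Finset.prod_nonneg fun _ _ => by positivity
  have amgm := Real.geom_mean_le_arith_mean Finset.univ (fun _ : Fin n => (1 : ℝ))
    (fun i => ((O i).card : ℝ)) (fun _ _ => zero_le_one) (by simpa using Nat.pos_of_ne_zero (by omega))
    fun _ _ => by positivity
  simp only [Real.rpow_one, Finset.sum_const, Finset.card_univ, Fintype.card_fin, nsmul_eq_mul,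
    mul_one, one_mul] at amgm
  have h2 : (∏ i, ((O i).card : ℝ)) ^ ((n : ℝ)⁻¹) ≤ m / n :=
    amgm.trans (div_le_div_of_nonneg_right hsum hn'.le)
  calc ∏ i, ((O i).card : ℝ) = ((∏ i, ((O i).card : ℝ)) ^ ((n : ℝ)⁻¹)) ^ n :=
        (Real.rpow_inv_natCast_pow hp (by omega)).symm
    _ ≤ _ := pow_le_pow_left₀ (Real.rpow_nonneg hp _) h2 n

/-- Giving to every player the best item of an optimal bundle loses at most a factor `m / n`. -/
theorem exists_items_prod_le {n m : ℕ} (hn : 1 ≤ n) {v : Profile n m}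
    (hv : ∀ i, (v i).Subadditive) (π : Fin m → Fin (2 * n)) {O : Assignment n m}
    (hO : IsAllocation O) (hpos : ∀ i, 0 < (v i).val (O i)) :
    ∃ A ∈ bundleRange π, ∏ i, (v i).val (O i) ≤ ((m : ℝ) / n) ^ n * ∏ i, (v i).val (A i) := by
  have hne : ∀ i, (O i).Nonempty := fun i => Finset.nonempty_iff_ne_empty.2 fun h => by
    have := hpos i
    rw [h, (v i).empty] at this
    exact lt_irrefl _ this
  choose j hj hle using fun i => (hv i).exists_item (hne i)
  refine ⟨fun i => {j i}, ⟨fun a b hab => ?_, fun i => Or.inr ⟨j i, rfl⟩⟩, ?_⟩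
  · rw [Finset.disjoint_singleton]
    intro h
    exact Finset.disjoint_left.1 (hO a b hab) (hj a) (h ▸ hj b)
  · calc ∏ i, (v i).val (O i) ≤ ∏ i, ((O i).card * (v i).val {j i}) :=
          Finset.prod_le_prod (fun i _ => (v i).nonneg _) fun i _ => hle i
      _ = (∏ i, ((O i).card : ℝ)) * ∏ i, (v i).val {j i} := Finset.prod_mul_distrib
      _ ≤ _ := mul_le_mul_of_nonneg_right (prod_card_le hn hO)
          (Finset.prod_nonneg fun i _ => (v i).nonneg _)

/-- Players with a valuable item in their bundle of `O` get that item. At least `n` of the `2n`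
bundles have none of these items, enough for the remaining players. -/
theorem exists_mem_bundleRange_prod_le {n m : ℕ} (hm : 1 ≤ m) {v : Profile n m}
    (π : Fin m → Fin (2 * n))
    {O : Assignment n m} (hO : IsAllocation O) {ρ : ℝ}
    (hgood : ∀ i, (∀ j ∈ O i, ρ * (v i).val {j} < (v i).val (O i)) →
      ∀ k, (v i).val (O i) ≤ ρ * (v i).val (bundle π k)) :
    ∃ A ∈ bundleRange π, ∏ i, (v i).val (O i) ≤ ρ ^ n * ∏ i, (v i).val (A i) := by
  classical
  let I : Finset (Fin n) := Finset.univ.filter fun i =>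
    ∃ j ∈ O i, (v i).val (O i) ≤ ρ * (v i).val {j}
  have hI : ∀ i ∈ I, ∃ j ∈ O i, (v i).val (O i) ≤ ρ * (v i).val {j} := fun i hi =>
    (Finset.mem_filter.1 hi).2
  have : Nonempty (Fin m) := ⟨⟨0, hm⟩⟩
  choose! j hj hle using hI
  let F : Finset (Fin (2 * n)) := (I.image fun i => π (j i))ᶜ
  have hcard : (Iᶜ).card ≤ F.card := by
    have h1 : (I.image fun i => π (j i)).card ≤ I.card := Finset.card_image_le
    have h2 : I.card ≤ n := by simpa using Finset.card_le_univ I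
    simp only [F, Finset.card_compl, Fintype.card_fin]
    omega
  obtain ⟨e⟩ : Nonempty ((Iᶜ : Finset (Fin n)) ↪ F) :=
    Function.Embedding.nonempty_of_card_le (by simpa only [Fintype.card_coe] using hcard)
  let A : Assignment n m := fun i =>
    if hi : i ∈ I then {j i} else bundle π (e ⟨i, Finset.mem_compl.2 hi⟩)
  have hmix : ∀ a ∈ I, ∀ b, (hb : b ∉ I) →
      j a ∉ bundle π (e ⟨b, Finset.mem_compl.2 hb⟩) := by
    intro a ha b hb h
    refine (Finset.mem_compl.1 (e ⟨b, Finset.mem_compl.2 hb⟩).2)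
      (Finset.mem_image.2 ⟨a, ha, (Finset.mem_filter.1 h).2⟩)
  refine ⟨A, ⟨fun a b hab => ?_, fun i => ?_⟩, ?_⟩
  · by_cases ha : a ∈ I <;> by_cases hb : b ∈ I
    · simp only [A, dif_pos ha, dif_pos hb, Finset.disjoint_singleton]
      intro h
      exact Finset.disjoint_left.1 (hO a b hab) (hj a ha) (h ▸ hj b hb)
    · simp only [A, dif_pos ha, dif_neg hb, Finset.disjoint_singleton_left]
      exact hmix a ha b hb
    · simp only [A, dif_neg ha, dif_pos hb, Finset.disjoint_singleton_right]
      exact hmix b hb a ha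
    · simp only [A, dif_neg ha, dif_neg hb]
      refine Finset.disjoint_left.2 fun x hx hx' => hab ?_
      have h := (Finset.mem_filter.1 hx).2.symm.trans (Finset.mem_filter.1 hx').2
      simpa using e.injective (Subtype.ext h)
  · by_cases hi : i ∈ I
    · exact Or.inr ⟨j i, by simp only [A, dif_pos hi]⟩
    · exact Or.inl ⟨e ⟨i, Finset.mem_compl.2 hi⟩, by simp only [A, dif_neg hi]⟩
  · have hi : ∀ i, (v i).val (O i) ≤ ρ * (v i).val (A i) := by
      intro i
      by_cases hi : i ∈ I
      · simpa only [A, dif_pos hi] using hle i hi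
      · simp only [A, dif_neg hi]
        refine hgood i (fun j hj => ?_) _
        by_contra h
        exact hi (Finset.mem_filter.2 ⟨Finset.mem_univ i, j, hj, not_lt.1 h⟩)
    calc ∏ i, (v i).val (O i) ≤ ∏ i, ρ * (v i).val (A i) :=
          Finset.prod_le_prod (fun i _ => (v i).nonneg _) fun i _ => hi i
      _ = _ := by rw [Finset.prod_mul_distrib]; simp

/-- If no item of `O` is worth more than a `1 / ρ` fraction of `O`, then a given random bundle is
worth less than that fraction for few partitions only: the greedy prices of `O` concentrate, and
prices bound values from below up to the factor `1 + log m`. -/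
theorem card_bad_partitions_le {n m : ℕ} (hn : 1 ≤ n) {v : ItemValuation m}
    (hv : v.Subadditive) {O : Finset (Fin m)} (hO : 0 < v.val O) {ρ : ℝ}
    (hρ : 8 * n * (1 + Real.log m) ≤ ρ) (hsmall : ∀ j ∈ O, ρ * v.val {j} < v.val O)
    (k : Fin (2 * n)) :
    ((Finset.univ.filter fun π : Fin m → Fin (2 * n) =>
        ρ * v.val (bundle π k) < v.val O).card : ℝ) ≤
      ((2 * n : ℕ) : ℝ) ^ m * Real.exp (-(ρ / (8 * n))) := by
  have hn' : (1 : ℝ) ≤ n := by exact_mod_cast hn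
  have hlog : 0 ≤ Real.log m := Real.log_natCast_nonneg m
  have hρ0 : 0 < ρ := lt_of_lt_of_le (by positivity) hρ
  obtain ⟨p, hp0, hpO, hpT⟩ := hv.exists_price O
  -- prices in units of `v(O) / ρ`, so that they are at most `1` and add up to at least `ρ`
  set x : Fin m → ℝ := fun j => if j ∈ O then ρ * p j / v.val O else 0 with hx
  have hx0 : ∀ j, 0 ≤ x j := fun j => by
    simp only [hx]
    split_ifs
    · exact div_nonneg (mul_nonneg hρ0.le (hp0 j)) hO.le
    · exact le_rfl
  have hx1 : ∀ j, x j ≤ 1 := fun j => by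
    simp only [hx]
    split_ifs with hj
    · rw [div_le_one hO]
      have h1 := hpT {j} (Finset.singleton_subset_iff.2 hj)
      simp only [Finset.sum_singleton, Finset.card_singleton] at h1
      have h2 : ((harmonic 1 : ℚ) : ℝ) = 1 := by simp [harmonic]
      rw [h2, one_mul] at h1
      exact (mul_le_mul_of_nonneg_left h1 hρ0.le).trans (hsmall j hj).le
    · exact zero_le_one
  have hxX : ρ ≤ ∑ j, x j := by
    have : ∑ j, x j = ρ * (∑ j ∈ O, p j) / v.val O := by
      simp only [hx, Finset.sum_ite_mem, Finset.univ_inter, Finset.mul_sum, Finset.sum_div]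
    rw [this, le_div_iff₀ hO]
    exact mul_le_mul_of_nonneg_left hpO hρ0.le
  have key := card_small_share_le (N := 2 * n) (by omega) x hx0 hx1 k
  refine (le_trans ?_ key).trans ?_
  · refine Nat.cast_le.2 (Finset.card_le_card fun π hπ => ?_)
    rw [Finset.mem_filter] at hπ ⊢
    refine ⟨Finset.mem_univ _, ?_⟩
    have hT : ∑ j ∈ O ∩ bundle π k, p j ≤ (1 + Real.log m) * v.val (bundle π k) := by
      refine (hpT _ Finset.inter_subset_left).trans ?_
      refine mul_le_mul ?_ (v.mono _ _ Finset.inter_subset_right) (v.nonneg _) (by positivity)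
      rcases (O ∩ bundle π k).eq_empty_or_nonempty with h | h
      · rw [h]; simp; positivity
      refine (harmonic_le_one_add_log _).trans ?_
      have hc : (O ∩ bundle π k).card ≤ m := by
        simpa using Finset.card_le_univ (O ∩ bundle π k)
      have := Real.log_le_log (by exact_mod_cast h.card_pos)
        (by exact_mod_cast hc : ((O ∩ bundle π k).card : ℝ) ≤ m)
      linarith
    have hs : (∑ j, if π j = k then x j else 0) = ρ / v.val O * ∑ j ∈ O ∩ bundle π k, p j := by
      rw [Finset.mul_sum, ← Finset.sum_filter]
      change ∑ j ∈ bundle π k, x j = _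
      simp only [hx]
      rw [Finset.sum_ite_mem, Finset.inter_comm]
      exact Finset.sum_congr rfl fun j _ => by ring
    rw [hs]
    have hv0 := v.nonneg (bundle π k)
    have h8 : (0 : ℝ) < 8 * n := by positivity
    have h3 : ρ / v.val O * ∑ j ∈ O ∩ bundle π k, p j ≤ 1 + Real.log m := by
      rw [div_mul_eq_mul_div, div_le_iff₀ hO]
      calc ρ * ∑ j ∈ O ∩ bundle π k, p j
          ≤ ρ * ((1 + Real.log m) * v.val (bundle π k)) := mul_le_mul_of_nonneg_left hT hρ0.le
        _ = (1 + Real.log m) * (ρ * v.val (bundle π k)) := by ring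
        _ ≤ _ := mul_le_mul_of_nonneg_left hπ.2.le (by positivity)
    refine h3.trans ?_
    push_cast
    rw [le_div_iff₀ (by positivity)]
    linarith
  · refine mul_le_mul_of_nonneg_left (Real.exp_le_exp.2 (neg_le_neg ?_)) (by positivity)
    have : (4 : ℝ) * ((2 * n : ℕ) : ℝ) = 8 * n := by push_cast; ring
    rw [this]
    exact div_le_div_of_nonneg_right hxX (by positivity)

/-- The union bound over all players and bundles: all but a `1 / m` fraction of the partitions is
good for an allocation `O`. -/
theorem one_sub_inv_le_partitionLaw_good {n m : ℕ} (hn : 1 ≤ n) (hm : 2 ≤ m) (hnm : n ≤ m)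
    {v : Profile n m} (hv : ∀ i, (v i).Subadditive) {O : Assignment n m}
    (hpos : ∀ i, 0 < (v i).val (O i)) {ρ : ℝ} (hρ : ρ = 64 * (n * Real.log m ^ 2)) :
    1 - 1 / (m : ℝ) ≤ (partitionLaw n m).real
      {π | ∀ i, (∀ j ∈ O i, ρ * (v i).val {j} < (v i).val (O i)) →
        ∀ k, (v i).val (O i) ≤ ρ * (v i).val (bundle π k)} := by
  classical
  have hn' : (1 : ℝ) ≤ n := by exact_mod_cast hn
  have hm' : (2 : ℝ) ≤ m := by exact_mod_cast hm
  have hL : 0.69 ≤ Real.log m :=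
    (by linarith [Real.log_two_gt_d9] : (0.69 : ℝ) ≤ Real.log 2).trans
      (Real.log_le_log two_pos hm')
  have hρ1 : 8 * n * (1 + Real.log m) ≤ ρ := by
    have : 8 * (1 + Real.log m) ≤ 64 * Real.log m ^ 2 := by nlinarith
    calc 8 * n * (1 + Real.log m) = n * (8 * (1 + Real.log m)) := by ring
      _ ≤ n * (64 * Real.log m ^ 2) := mul_le_mul_of_nonneg_left this (by linarith)
      _ = ρ := by rw [hρ]; ring
  -- `ρ / (8n) = 8 log² m ≥ 4 log m`, so each of the `2n²` pairs of a player and a bundle fails with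
  -- probability at most `m⁻⁴`, and `2n² ≤ m³`
  have hexp : Real.exp (-(ρ / (8 * n))) ≤ 1 / (m : ℝ) ^ 4 := by
    have e : ρ / (8 * n) = 8 * Real.log m ^ 2 := by
      rw [hρ]; field_simp; ring
    have e2 : (1 : ℝ) / m ^ 4 = Real.exp (-(4 * Real.log m)) := by
      rw [Real.exp_neg, mul_comm, Real.exp_mul, Real.exp_log (by linarith), one_div]
      norm_cast
    rw [e, e2, Real.exp_le_exp]
    nlinarith
  set good : Finset (Fin m → Fin (2 * n)) := Finset.univ.filter fun π =>
    ∀ i, (∀ j ∈ O i, ρ * (v i).val {j} < (v i).val (O i)) →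
        ∀ k, (v i).val (O i) ≤ ρ * (v i).val (bundle π k) with hgood
  have hset : {π : Fin m → Fin (2 * n) | ∀ i,
      (∀ j ∈ O i, ρ * (v i).val {j} < (v i).val (O i)) →
        ∀ k, (v i).val (O i) ≤ ρ * (v i).val (bundle π k)} = (good : Set _) := by
    ext π; simp [hgood]
  have hN : (0 : ℝ) < ((2 * n : ℕ) : ℝ) ^ m := by positivity
  rw [hset, partitionLaw_real m hn, le_div_iff₀ hN]
  have hcompl : ((goodᶜ).card : ℝ) ≤
      n * ((2 * n : ℕ) * (((2 * n : ℕ) : ℝ) ^ m * (1 / (m : ℝ) ^ 4))) := by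
    let bad : Fin n → Fin (2 * n) → Finset (Fin m → Fin (2 * n)) := fun i k =>
      if ∀ j ∈ O i, ρ * (v i).val {j} < (v i).val (O i) then
        Finset.univ.filter fun π => ρ * (v i).val (bundle π k) < (v i).val (O i)
      else ∅
    have hsub : goodᶜ ⊆ Finset.univ.biUnion fun i => Finset.univ.biUnion fun k => bad i k := by
      intro π hπ
      simp only [hgood, Finset.mem_compl, Finset.mem_filter, Finset.mem_univ, true_and] at hπ
      push Not at hπ
      obtain ⟨i, hi, k, hk⟩ := hπ
      simp only [Finset.mem_biUnion, Finset.mem_univ, true_and]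
      refine ⟨i, k, ?_⟩
      simp only [bad, if_pos hi, Finset.mem_filter, Finset.mem_univ, true_and]
      exact hk
    have hb : ∀ i k, ((bad i k).card : ℝ) ≤ ((2 * n : ℕ) : ℝ) ^ m * (1 / (m : ℝ) ^ 4) := by
      intro i k
      simp only [bad]
      split_ifs with h
      · exact (card_bad_partitions_le hn (hv i) (hpos i) hρ1 h k).trans
          (mul_le_mul_of_nonneg_left hexp hN.le)
      · simp only [Finset.card_empty, Nat.cast_zero]
        positivity
    calc ((goodᶜ).card : ℝ)
        ≤ ((∑ i, ∑ k, (bad i k).card : ℕ) : ℝ) := by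
          refine Nat.cast_le.2 ((Finset.card_le_card hsub).trans (Finset.card_biUnion_le.trans ?_))
          exact Finset.sum_le_sum fun i _ => Finset.card_biUnion_le
      _ ≤ ∑ _i : Fin n, ∑ _k : Fin (2 * n), ((2 * n : ℕ) : ℝ) ^ m * (1 / (m : ℝ) ^ 4) := by
          push_cast
          exact Finset.sum_le_sum fun i _ => Finset.sum_le_sum fun k _ => by exact_mod_cast hb i k
      _ = _ := by simp
  have hc : ((goodᶜ).card : ℝ) = ((2 * n : ℕ) : ℝ) ^ m - good.card := by
    rw [Finset.card_compl, Nat.cast_sub (Finset.card_le_univ _)]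
    simp
  have hfrac : (n : ℝ) * ((2 * n : ℕ) * (((2 * n : ℕ) : ℝ) ^ m * (1 / (m : ℝ) ^ 4))) ≤
      1 / m * ((2 * n : ℕ) : ℝ) ^ m := by
    have h1 : (n : ℝ) * (2 * n) * (1 / (m : ℝ) ^ 4) ≤ 1 / m := by
      have hnm' : (n : ℝ) ≤ m := by exact_mod_cast hnm
      rw [mul_one_div, div_le_div_iff₀ (by positivity) (by positivity)]
      have h2 : (n : ℝ) * n ≤ m * m := mul_le_mul hnm' hnm' (by linarith) (by linarith)
      have h3 : (2 : ℝ) * (m * m * m) ≤ m * (m * m * m) :=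
        mul_le_mul_of_nonneg_right hm' (by positivity)
      nlinarith [mul_le_mul_of_nonneg_right h2 (by linarith : (0 : ℝ) ≤ m)]
    calc _ = ((n : ℝ) * (2 * n) * (1 / (m : ℝ) ^ 4)) * ((2 * n : ℕ) : ℝ) ^ m := by push_cast; ring
      _ ≤ _ := mul_le_mul_of_nonneg_right h1 hN.le
  rw [hc] at hcompl
  have : (1 - 1 / (m : ℝ)) * ((2 * n : ℕ) : ℝ) ^ m =
    ((2 * n : ℕ) : ℝ) ^ m - 1 / m * ((2 * n : ℕ) : ℝ) ^ m := by ring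
  linarith

theorem exists_isAllocation_max {n m : ℕ} (v : Profile n m) :
    ∃ O : Assignment n m, IsAllocation O ∧ ∀ O', IsAllocation O' → nsw v O' ≤ nsw v O := by
  classical
  obtain ⟨O, hO, hmax⟩ := Finset.exists_max_image
    (Finset.univ.filter fun O : Assignment n m => IsAllocation O) (nsw v)
    ⟨fun _ => ∅, Finset.mem_filter.2 ⟨Finset.mem_univ _, fun _ _ _ => Finset.disjoint_empty_left _⟩⟩
  exact ⟨O, (Finset.mem_filter.1 hO).2, fun O' hO' =>
    hmax O' (Finset.mem_filter.2 ⟨Finset.mem_univ _, hO'⟩)⟩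

theorem approximation {n m : ℕ} (hn : 1 ≤ n) (hm : 1 ≤ m)
    {f : (Fin m → Fin (2 * n)) → Profile n m → Assignment n m}
    (hf : ∀ π, IsMaximalInRange (bundleRange π) (f π)) (v : Profile n m)
    (hv : ∀ i, (v i).Subadditive) :
    1 - 1 / (m : ℝ) ≤ (partitionLaw n m).real
      {π | ApproximatesNSW (min ((m : ℝ) / n) (64 * (n * Real.log m ^ 2))) v (f π v)} := by
  have hn' : (1 : ℝ) ≤ n := by exact_mod_cast hn
  have hm' : (1 : ℝ) ≤ m := by exact_mod_cast hm
  have : Nonempty (Fin (2 * n)) := ⟨⟨0, by omega⟩⟩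
  have : IsProbabilityMeasure
      (ProbabilityTheory.uniformOn (Set.univ : Set (Fin (2 * n)))) :=
    ProbabilityTheory.isProbabilityMeasure_uniformOn Set.finite_univ Set.univ_nonempty
  have : IsProbabilityMeasure (partitionLaw n m) := by unfold partitionLaw; infer_instance
  set ρ := 64 * (n * Real.log m ^ 2) with hρ
  have hρ0 : 0 ≤ ρ := by positivity
  have hmin0 : 0 ≤ min ((m : ℝ) / n) ρ := le_min (by positivity) hρ0
  obtain ⟨O, hO, hmax⟩ := exists_isAllocation_max v
  -- it suffices to compare with one optimal allocation
  have hred : ∀ π, nsw v O ≤ min ((m : ℝ) / n) ρ * nsw v (f π v) →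
      ApproximatesNSW (min ((m : ℝ) / n) ρ) v (f π v) := fun π h O' hO' => (hmax O' hO').trans h
  have hall : (∀ π, nsw v O ≤ min ((m : ℝ) / n) ρ * nsw v (f π v)) →
      1 - 1 / (m : ℝ) ≤ (partitionLaw n m).real
        {π | ApproximatesNSW (min ((m : ℝ) / n) ρ) v (f π v)} := by
    intro h
    rw [Set.eq_univ_of_forall (s := {π | ApproximatesNSW (min ((m : ℝ) / n) ρ) v (f π v)})
      fun π => hred π (h π), probReal_univ]
    have : (0 : ℝ) ≤ 1 / m := by positivity
    linarith
  by_cases hpos : 0 < nsw v O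
  swap
  · exact hall fun π => (not_lt.1 hpos).trans
      (mul_nonneg hmin0 (Real.rpow_nonneg (prod_val_nonneg v _) _))
  have hpos' : ∀ i, 0 < (v i).val (O i) := fun i =>
    lt_of_le_of_ne ((v i).nonneg _) fun h0 =>
      ((nsw_pos_iff hn v O).1 hpos).ne' (Finset.prod_eq_zero (Finset.mem_univ i) h0.symm)
  rcases le_or_gt ((m : ℝ) / n) ρ with hle | hlt
  · refine hall fun π => ?_
    rw [min_eq_left hle]
    obtain ⟨A, hA, h⟩ := exists_items_prod_le hn hv π hO hpos'
    exact approximatesNSW_of_prod_le hn (hf π) (by positivity) hA h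
  rcases hm.eq_or_lt with rfl | hm2
  · simp
  have hnm : n ≤ m := by
    have h : ∀ i, (O i).Nonempty := fun i => Finset.nonempty_iff_ne_empty.2 fun h => by
      have := hpos' i
      rw [h, (v i).empty] at this
      exact lt_irrefl _ this
    choose j hj using h
    have hinj : Function.Injective j := fun a b hab => by
      by_contra hne
      exact Finset.disjoint_left.1 (hO a b hne) (hj a) (hab ▸ hj b)
    simpa using Fintype.card_le_of_injective j hinj
  refine (one_sub_inv_le_partitionLaw_good hn hm2 hnm hv hpos' hρ).trans
    (measureReal_mono (fun π hπ => hred π ?_) (measure_ne_top _ _))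
  rw [min_eq_right hlt.le]
  obtain ⟨A, hA, h⟩ := exists_mem_bundleRange_prod_le hm π hO hπ
  exact approximatesNSW_of_prod_le hn (hf π) hρ0 hA h

/-- The minimum is at most the geometric mean of the two bounds. -/
lemma min_ratio_le {n m : ℕ} (hn : 1 ≤ n) :
    min ((m : ℝ) / n) (64 * (n * Real.log m ^ 2)) ≤ 8 * (Real.sqrt m * Real.log m) := by
  have hn' : (0 : ℝ) < n := by positivity
  have hlog : 0 ≤ Real.log m := Real.log_natCast_nonneg m
  refine abs_le_of_sq_le_sq' ?_ (by positivity) |>.2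
  have h0 : 0 ≤ min ((m : ℝ) / n) (64 * (n * Real.log m ^ 2)) := le_min (by positivity) (by positivity)
  calc min ((m : ℝ) / n) (64 * (n * Real.log m ^ 2)) ^ 2
      ≤ (m : ℝ) / n * (64 * (n * Real.log m ^ 2)) := by
        rw [sq]; exact mul_le_mul (min_le_left _ _) (min_le_right _ _) h0 (by positivity)
    _ = (8 * (Real.sqrt m * Real.log m)) ^ 2 := by
        rw [mul_pow, mul_pow, Real.sq_sqrt (by positivity)]
        field_simp
        ring

/-! ### Matching players to objects by dynamic programming over sets of players -/

lemma testBit_sub_two_pow {U i : ℕ} (h : U.testBit i = true) (j : ℕ) :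
    (U - 2 ^ i).testBit j = (U.testBit j && decide (j ≠ i)) := by
  induction i generalizing U j with
  | zero =>
    have h1 : U % 2 = 1 := by simpa using h
    cases j with
    | zero => simp; omega
    | succ j =>
      have h2 : (U - 1) / 2 = U / 2 := by omega
      simp [Nat.testBit_add_one, h2]
  | succ i ih =>
    have h1 : (U / 2).testBit i = true := by rwa [← Nat.testBit_add_one]
    have hge : U / 2 ≥ 2 ^ i := Nat.ge_two_pow_of_testBit h1
    cases j with
    | zero => simp [Nat.pow_succ]; omega
    | succ j =>
      have h2 : (U - 2 ^ (i + 1)) / 2 = U / 2 - 2 ^ i := by rw [Nat.pow_succ]; omega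
      rw [Nat.testBit_add_one, h2, ih h1, Nat.testBit_add_one]
      simp

/-- `σ` matches the players in the set with binary code `U` to distinct available objects with
numbers below `t`. -/
def Feasible (n : ℕ) (av : ℕ → Prop) (t U : ℕ) (σ : ℕ → ℕ) : Prop :=
  (∀ i < n, U.testBit i = true → σ i < t ∧ av (σ i)) ∧
  ∀ i < n, ∀ j < n, U.testBit i = true → U.testBit j = true → σ i = σ j → i = j

/-- The product of the weights of the matching `σ` of the players coded by `U`. -/
noncomputable def matchWeight (n : ℕ) (w : ℕ → ℕ → ℝ) (U : ℕ) (σ : ℕ → ℕ) : ℝ :=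
  ∏ i ∈ Finset.range n, if U.testBit i = true then w i (σ i) else 1

/-- `d` is the maximum weight of a matching that satisfies `F`, or `0` if there is none, and if
`d ≠ 0` it is the weight of `σ`, which satisfies `G`. -/
structure IsBest (n : ℕ) (w : ℕ → ℕ → ℝ) (U : ℕ) (F G : (ℕ → ℕ) → Prop) (d : ℝ) (σ : ℕ → ℕ) :
    Prop where
  nonneg : 0 ≤ d
  attained : 0 < d → G σ ∧ matchWeight n w U σ = d
  upper : ∀ τ, F τ → matchWeight n w U τ ≤ d

/-- The invariant of the table of the dynamic program: an optimal matching of `U` to available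
objects below `t`. -/
def TableEntry (n : ℕ) (av : ℕ → Prop) (w : ℕ → ℕ → ℝ) (t U : ℕ) (d : ℝ) (σ : ℕ → ℕ) : Prop :=
  IsBest n w U (Feasible n av t U) (Feasible n av t U) d σ

/-- The invariant while the entry of `U` is updated for the object `t`, when the matchings that
give `t` to a player below `i` have been taken into account. -/
def PartialEntry (n : ℕ) (av : ℕ → Prop) (w : ℕ → ℕ → ℝ) (t U i : ℕ) (d : ℝ) (σ : ℕ → ℕ) : Prop :=
  IsBest n w U
    (fun τ => Feasible n av (t + 1) U τ ∧ (Feasible n av t U τ ∨ ∃ k < i, U.testBit k = true ∧ τ k = t))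
    (Feasible n av (t + 1) U) d σ

lemma Feasible.congr {n t U : ℕ} {av : ℕ → Prop} {σ τ : ℕ → ℕ} (h : Feasible n av t U σ)
    (he : ∀ l < n, τ l = σ l) : Feasible n av t U τ :=
  ⟨fun i hi hb => by rw [he i hi]; exact h.1 i hi hb,
    fun i hi j hj h1 h2 e => h.2 i hi j hj h1 h2 (by rw [← he i hi, ← he j hj, e])⟩

lemma matchWeight_congr {n U : ℕ} {w : ℕ → ℕ → ℝ} {σ τ : ℕ → ℕ} (he : ∀ l < n, τ l = σ l) :
    matchWeight n w U τ = matchWeight n w U σ :=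
  Finset.prod_congr rfl fun l hl => by rw [he l (Finset.mem_range.1 hl)]

section Table

variable {n : ℕ} {av : ℕ → Prop} {w : ℕ → ℕ → ℝ} {t U i : ℕ} {d : ℝ} {σ : ℕ → ℕ}

lemma Feasible.mono {τ : ℕ → ℕ} (h : Feasible n av t U τ) : Feasible n av (t + 1) U τ :=
  ⟨fun i hi hb => ⟨(h.1 i hi hb).1.trans (Nat.lt_succ_self t), (h.1 i hi hb).2⟩, h.2⟩

lemma tableEntry_zero (hU : U < 2 ^ n) :
    TableEntry n av w 0 U (if U = 0 then 1 else 0) σ := by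
  rcases eq_or_ne U 0 with rfl | h
  · rw [if_pos rfl]
    exact ⟨zero_le_one, fun _ => ⟨⟨by simp, by simp⟩, by simp [matchWeight]⟩,
      fun τ _ => by simp [matchWeight]⟩
  · rw [if_neg h]
    refine ⟨le_rfl, fun h => absurd h (lt_irrefl _), fun τ hτ => ?_⟩
    obtain ⟨i, hi⟩ := Nat.exists_testBit_of_ne_zero h
    have hin : i < n := by
      by_contra hin
      have := Nat.testBit_lt_two_pow (hU.trans_le (Nat.pow_le_pow_right two_pos (not_lt.1 hin)))
      rw [this] at hi
      cases hi
    exact absurd (hτ.1 i hin hi).1 (Nat.not_lt_zero _)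

lemma TableEntry.succ_of_not_av (h : TableEntry n av w t U d σ) (hav : ¬ av t) :
    TableEntry n av w (t + 1) U d σ := by
  have hF : ∀ τ, Feasible n av (t + 1) U τ → Feasible n av t U τ := fun τ hτ =>
    ⟨fun i hi hb => by
      obtain ⟨h1, h2⟩ := hτ.1 i hi hb
      exact ⟨lt_of_le_of_ne (Nat.lt_succ_iff.1 h1) fun e => hav (e ▸ h2), h2⟩, hτ.2⟩
  exact ⟨h.nonneg, fun h0 => ⟨(h.attained h0).1.mono, (h.attained h0).2⟩,
    fun τ hτ => h.upper τ (hF τ hτ)⟩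

lemma TableEntry.partialEntry_zero (h : TableEntry n av w t U d σ) :
    PartialEntry n av w t U 0 d σ :=
  ⟨h.nonneg, fun h0 => ⟨(h.attained h0).1.mono, (h.attained h0).2⟩, fun τ hτ => by
    rcases hτ.2 with h1 | ⟨k, hk, -⟩
    · exact h.upper τ h1
    · exact absurd hk (Nat.not_lt_zero _)⟩

lemma PartialEntry.tableEntry (h : PartialEntry n av w t U n d σ) :
    TableEntry n av w (t + 1) U d σ :=
  ⟨h.nonneg, h.attained, fun τ hτ => h.upper τ ⟨hτ, by
    by_cases hk : ∃ k < n, U.testBit k = true ∧ τ k = t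
    · exact Or.inr hk
    · refine Or.inl ⟨fun i hi hb => ?_, hτ.2⟩
      obtain ⟨h1, h2⟩ := hτ.1 i hi hb
      exact ⟨lt_of_le_of_ne (Nat.lt_succ_iff.1 h1) fun e => hk ⟨i, hi, hb, e⟩, h2⟩⟩⟩

lemma PartialEntry.succ_of_bit_false (h : PartialEntry n av w t U i d σ)
    (hb : U.testBit i = false) : PartialEntry n av w t U (i + 1) d σ :=
  ⟨h.nonneg, h.attained, fun τ hτ => h.upper τ ⟨hτ.1, by
    rcases hτ.2 with h1 | ⟨k, hk, hbk, e⟩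
    · exact Or.inl h1
    · refine Or.inr ⟨k, lt_of_le_of_ne (Nat.lt_succ_iff.1 hk) fun e => ?_, hbk, e⟩
      rw [e, hb] at hbk
      cases hbk⟩⟩

/-- The weight of a matching, split at player `i`. -/
lemma matchWeight_eq_mul {τ σ : ℕ → ℕ} (hi : i < n) (hb : U.testBit i = true)
    (hτ : ∀ l < n, l ≠ i → τ l = σ l) :
    matchWeight n w U τ = matchWeight n w (U - 2 ^ i) σ * w i (τ i) := by
  unfold matchWeight
  rw [← Finset.mul_prod_erase _ _ (Finset.mem_range.2 hi), mul_comm, if_pos hb]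
  congr 1
  rw [← Finset.mul_prod_erase (Finset.range n)
    (fun l => if (U - 2 ^ i).testBit l = true then w l (σ l) else 1) (Finset.mem_range.2 hi)]
  have h1 : (U - 2 ^ i).testBit i = false := by rw [testBit_sub_two_pow hb]; simp
  simp only [h1, Bool.false_eq_true, if_false, one_mul]
  refine Finset.prod_congr rfl fun l hl => ?_
  have hl' := Finset.ne_of_mem_erase hl
  rw [testBit_sub_two_pow hb, hτ l (Finset.mem_range.1 (Finset.mem_of_mem_erase hl)) hl']
  simp [hl']

lemma Feasible.remove {τ : ℕ → ℕ} (h : Feasible n av (t + 1) U τ) (hi : i < n)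
    (hb : U.testBit i = true) (e : τ i = t) : Feasible n av t (U - 2 ^ i) τ := by
  have hsub : ∀ l, (U - 2 ^ i).testBit l = true → U.testBit l = true ∧ l ≠ i := fun l hl => by
    simpa [testBit_sub_two_pow hb] using hl
  refine ⟨fun l hl hbl => ?_, fun a ha b hb' h1 h2 => h.2 a ha b hb' (hsub a h1).1 (hsub b h2).1⟩
  obtain ⟨h1, h2⟩ := h.1 l hl (hsub l hbl).1
  exact ⟨lt_of_le_of_ne (Nat.lt_succ_iff.1 h1) fun e' =>
    (hsub l hbl).2 (h.2 l hl i hi (hsub l hbl).1 hb (e'.trans e.symm)), h2⟩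

lemma Feasible.insert {τ : ℕ → ℕ} (h : Feasible n av t (U - 2 ^ i) σ)
    (hb : U.testBit i = true) (hav : av t) (e : τ i = t) (hτ : ∀ l < n, l ≠ i → τ l = σ l) :
    Feasible n av (t + 1) U τ := by
  have hsub : ∀ l, l ≠ i → U.testBit l = true → (U - 2 ^ i).testBit l = true := fun l h1 h2 => by
    simp [testBit_sub_two_pow hb, h1, h2]
  have hlt : ∀ l < n, l ≠ i → U.testBit l = true → τ l < t ∧ av (τ l) := fun l hl hne hbl => by
    rw [hτ l hl hne]
    exact h.1 l hl (hsub l hne hbl)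
  refine ⟨fun l hl hbl => ?_, fun a ha b hb' h1 h2 hab => ?_⟩
  · rcases eq_or_ne l i with rfl | hne
    · rw [e]; exact ⟨Nat.lt_succ_self t, hav⟩
    · exact ⟨(hlt l hl hne hbl).1.trans (Nat.lt_succ_self t), (hlt l hl hne hbl).2⟩
  · rcases eq_or_ne a i with hai | hai <;> rcases eq_or_ne b i with hbi | hbi
    · rw [hai, hbi]
    · exact absurd (hab.symm.trans (hai ▸ e)) (hlt b hb' hbi h2).1.ne
    · exact absurd (hab.trans (hbi ▸ e)) (hlt a ha hai h1).1.ne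
    · refine h.2 a ha b hb' (hsub a hai h1) (hsub b hbi h2) ?_
      rw [← hτ a ha hai, ← hτ b hb' hbi, hab]

/-- The candidates that give the object `t` to player `i` are dominated by the best matching of
`U \ {i}` to earlier objects. -/
lemma matchWeight_le_of_last {d' : ℝ} {σ' τ : ℕ → ℕ} (hw : 0 ≤ w i t) (hi : i < n)
    (hb : U.testBit i = true) (h' : TableEntry n av w t (U - 2 ^ i) d' σ')
    (hτ : Feasible n av (t + 1) U τ) (e : τ i = t) : matchWeight n w U τ ≤ d' * w i t := by
  rw [matchWeight_eq_mul hi hb (fun _ _ _ => rfl : ∀ l < n, l ≠ i → τ l = τ l), e]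
  exact mul_le_mul_of_nonneg_right (h'.upper τ (hτ.remove hi hb e)) hw

lemma PartialEntry.succ_of_le {d' : ℝ} {σ' : ℕ → ℕ} (h : PartialEntry n av w t U i d σ)
    (hw : 0 ≤ w i t) (hi : i < n) (hb : U.testBit i = true)
    (h' : TableEntry n av w t (U - 2 ^ i) d' σ') (hle : d' * w i t ≤ d) :
    PartialEntry n av w t U (i + 1) d σ := by
  refine ⟨h.nonneg, h.attained, fun τ hτ => ?_⟩
  rcases hτ.2 with h1 | ⟨k, hk, hbk, e⟩
  · exact h.upper τ ⟨hτ.1, Or.inl h1⟩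
  · rcases (Nat.lt_succ_iff.1 hk).eq_or_lt with rfl | hlt
    · exact (matchWeight_le_of_last hw hi hb h' hτ.1 e).trans hle
    · exact h.upper τ ⟨hτ.1, Or.inr ⟨k, hlt, hbk, e⟩⟩

lemma PartialEntry.succ_of_lt {d' : ℝ} {σ' τ : ℕ → ℕ} (h : PartialEntry n av w t U i d σ)
    (hw : 0 ≤ w i t) (hi : i < n) (hb : U.testBit i = true) (hav : av t)
    (h' : TableEntry n av w t (U - 2 ^ i) d' σ') (hlt : d < d' * w i t)
    (e : τ i = t) (hτ : ∀ l < n, l ≠ i → τ l = σ' l) :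
    PartialEntry n av w t U (i + 1) (d' * w i t) τ := by
  have hpos : 0 < d' := by
    rcases h'.nonneg.eq_or_lt with h0 | h0
    · rw [← h0, zero_mul] at hlt
      exact absurd hlt h.nonneg.not_gt
    · exact h0
  refine ⟨h.nonneg.trans hlt.le, fun _ => ⟨?_, ?_⟩, fun ρ hρ => ?_⟩
  · exact (h'.attained hpos).1.insert hb hav e hτ
  · rw [matchWeight_eq_mul hi hb hτ, (h'.attained hpos).2, e]
  · rcases hρ.2 with h1 | ⟨k, hk, hbk, ek⟩
    · exact (h.upper ρ ⟨hρ.1, Or.inl h1⟩).trans hlt.le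
    · rcases (Nat.lt_succ_iff.1 hk).eq_or_lt with rfl | hlt'
      · exact matchWeight_le_of_last hw hi hb h' hρ.1 ek
      · exact (h.upper ρ ⟨hρ.1, Or.inr ⟨k, hlt', hbk, ek⟩⟩).trans hlt.le

end Table

/-! ### Allocations in the range as matchings -/

/-- The objects that are matched to players: the objects `t < 2n` are the bundles, the objects
`2n + j` are the single items `j`, and `2n + m` is the bundle of all items. -/
def object {n m : ℕ} (π : Fin m → Fin (2 * n)) (t : ℕ) : Finset (Fin m) :=
  Finset.univ.filter fun x => t = π x ∨ t = 2 * n + x ∨ t = 2 * n + m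

/-- The objects that may be matched when the bundles coded by `B` are reserved: these bundles, and
the items outside of them. -/
def Available {n m : ℕ} (π : Fin m → Fin (2 * n)) (B t : ℕ) : Prop :=
  (t < 2 * n → B.testBit t = true) ∧ ∀ j : Fin m, t = 2 * n + j → B.testBit (π j) = false

/-- The value of the object `t` for player `i`. -/
noncomputable def objectValue {n m : ℕ} (v : Profile n m) (π : Fin m → Fin (2 * n)) (i t : ℕ) : ℝ :=
  if h : i < n then (v ⟨i, h⟩).val (object π t) else 0

lemma objectValue_nonneg {n m : ℕ} (v : Profile n m) (π : Fin m → Fin (2 * n)) (i t : ℕ) :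
    0 ≤ objectValue v π i t := by
  unfold objectValue
  split_ifs
  · exact (v _).nonneg _
  · exact le_rfl

section Range

variable {n m : ℕ} (π : Fin m → Fin (2 * n))

lemma object_bundle (k : Fin (2 * n)) : object π k = bundle π k := by
  ext x
  simp only [object, bundle, Finset.mem_filter, Finset.mem_univ, true_and]
  have := k.2
  constructor
  · rintro (h | h | h)
    · exact Fin.ext h.symm
    · omega
    · omega
  · rintro rfl
    exact Or.inl rfl

lemma object_item (j : Fin m) : object π (2 * n + j) = {j} := by
  ext x
  simp only [object, Finset.mem_filter, Finset.mem_univ, true_and, Finset.mem_singleton]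
  have h1 := (π x).2
  have h2 := j.2
  constructor
  · rintro (h | h | h)
    · omega
    · exact Fin.ext (by omega)
    · omega
  · rintro rfl
    exact Or.inr (Or.inl rfl)

lemma object_univ : object π (2 * n + m) = Finset.univ := by
  ext x
  simp [object]

lemma mem_bundleRange_of_feasible {B : ℕ} {σ : ℕ → ℕ}
    (h : Feasible n (Available π B) (2 * n + m) (2 ^ n - 1) σ) :
    (fun i : Fin n => object π (σ i)) ∈ bundleRange π := by
  have hbit : ∀ i : Fin n, (2 ^ n - 1).testBit i = true := fun i => by simp
  have hcase : ∀ i : Fin n, (∃ k : Fin (2 * n), σ i = k ∧ B.testBit k = true) ∨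
      ∃ j : Fin m, σ i = 2 * n + j ∧ B.testBit (π j) = false := by
    intro i
    obtain ⟨h1, h2, h3⟩ := h.1 i i.2 (hbit i)
    rcases lt_or_ge (σ i) (2 * n) with hlt | hge
    · exact Or.inl ⟨⟨σ i, hlt⟩, rfl, h2 hlt⟩
    · have e : σ i = 2 * n + (⟨σ i - 2 * n, by omega⟩ : Fin m) := by simp; omega
      exact Or.inr ⟨_, e, h3 _ e⟩
  have hinj : ∀ i j : Fin n, σ i = σ j → i = j := fun i j e =>
    Fin.ext (h.2 i i.2 j j.2 (hbit i) (hbit j) e)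
  have hmix : ∀ (k : Fin (2 * n)) (j : Fin m), B.testBit k = true → B.testBit (π j) = false →
      j ∉ bundle π k := by
    intro k j hk hj hmem
    rw [(Finset.mem_filter.1 hmem).2, hk] at hj
    cases hj
  refine ⟨fun a b hab => ?_, fun i => ?_⟩
  · rcases hcase a with ⟨k, hk, hkB⟩ | ⟨j, hj, hjB⟩ <;>
      rcases hcase b with ⟨k', hk', hkB'⟩ | ⟨j', hj', hjB'⟩
    · simp only [hk, hk', object_bundle]
      refine Finset.disjoint_left.2 fun x hx hx' => hab (hinj a b ?_)
      rw [hk, hk', ← (Finset.mem_filter.1 hx).2, ← (Finset.mem_filter.1 hx').2]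
    · simp only [hk, hj', object_bundle, object_item, Finset.disjoint_singleton_right]
      exact hmix k j' hkB hjB'
    · simp only [hj, hk', object_bundle, object_item, Finset.disjoint_singleton_left]
      exact hmix k' j hkB' hjB
    · simp only [hj, hj', object_item, Finset.disjoint_singleton]
      rintro rfl
      exact hab (hinj a b (hj.trans hj'.symm))
  · rcases hcase i with ⟨k, hk, -⟩ | ⟨j, hj, -⟩
    · exact Or.inl ⟨k, by simp only [hk, object_bundle]⟩
    · exact Or.inr ⟨j, by simp only [hj, object_item]⟩

lemma exists_feasible_of_mem_bundleRange {A : Assignment n m} (hA : A ∈ bundleRange π)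
    (hne : ∀ i, (A i).Nonempty) :
    ∃ B < 2 ^ (2 * n), ∃ σ : ℕ → ℕ, Feasible n (Available π B) (2 * n + m) (2 ^ n - 1) σ ∧
      ∀ i : Fin n, A i = object π (σ i) := by
  classical
  have hcase : ∀ i, ∃ t, A i = object π t ∧ ((∃ k : Fin (2 * n), t = k ∧ A i = bundle π k) ∨
      ∃ j : Fin m, t = 2 * n + j ∧ A i = {j}) := by
    intro i
    rcases hA.2 i with ⟨k, hk⟩ | ⟨j, hj⟩
    · exact ⟨k, hk.trans (object_bundle π k).symm, Or.inl ⟨k, rfl, hk⟩⟩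
    · exact ⟨2 * n + j, hj.trans (object_item π j).symm, Or.inr ⟨j, rfl, hj⟩⟩
  choose s hs hs' using hcase
  -- the reserved bundles are those given to some player
  let B := Nat.ofBits fun k : Fin (2 * n) => decide (∃ i, s i = k)
  have hB : ∀ k : Fin (2 * n), B.testBit k = decide (∃ i, s i = k) := fun k =>
    Nat.testBit_ofBits_lt _ k k.2
  refine ⟨B, Nat.ofBits_lt_two_pow _, fun i => if hi : i < n then s ⟨i, hi⟩ else 0,
    ⟨fun i hi _ => ?_, fun a ha b hb _ _ e => ?_⟩, fun i => by simpa using hs i⟩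
  · simp only [dif_pos hi]
    rcases hs' ⟨i, hi⟩ with ⟨k, hk, hAk⟩ | ⟨j, hj, hAj⟩
    · refine ⟨by omega, fun _ => ?_, fun j hj => by omega⟩
      rw [hk, hB]
      exact decide_eq_true ⟨_, hk⟩
    · refine ⟨by omega, fun h => by omega, fun j' hj' => ?_⟩
      obtain rfl : j' = j := Fin.ext (by omega)
      rw [hB]
      refine decide_eq_false ?_
      rintro ⟨i', hi'⟩
      have hne' : i' ≠ ⟨i, hi⟩ := by
        rintro rfl
        have := (π j').2
        omega
      have hmem : j' ∈ A i' := by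
        rw [hs i', hi', object_bundle]
        exact Finset.mem_filter.2 ⟨Finset.mem_univ _, rfl⟩
      exact Finset.disjoint_left.1 (hA.1 _ _ hne') hmem (hAj ▸ Finset.mem_singleton_self j')
  · simp only [dif_pos ha, dif_pos hb] at e
    by_contra hab
    have hd := hA.1 ⟨a, ha⟩ ⟨b, hb⟩ fun h => hab (congrArg Fin.val h)
    rw [hs ⟨a, ha⟩, hs ⟨b, hb⟩, e, disjoint_self, Finset.bot_eq_empty] at hd
    have := hne ⟨b, hb⟩
    rw [hs ⟨b, hb⟩, hd] at this
    exact Finset.not_nonempty_empty this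

end Range

/-! ### Total correctness of programs with bounds on steps and queries -/

/-- The names of the arrays of natural numbers that a program assigns to. -/
def Prog.natWrites : Prog → List ℕ
  | .skip => []
  | .setNat a _ _ _ => [a]
  | .setReal _ _ _ _ => []
  | .query _ _ _ _ _ _ => []
  | .seq c d => c.natWrites ++ d.natWrites
  | .ite _ c d => c.natWrites ++ d.natWrites
  | .while _ c => c.natWrites

/-- The names of the arrays of real numbers that a program assigns to. -/
def Prog.realWrites : Prog → List ℕ
  | .skip => []
  | .setNat _ _ _ _ => []
  | .setReal a _ _ _ => [a]
  | .query a _ _ _ _ _ => [a]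
  | .seq c d => c.realWrites ++ d.realWrites
  | .ite _ c d => c.realWrites ++ d.realWrites
  | .while _ c => c.realWrites

/-- The states `s` and `s'` agree on all arrays that `c` does not assign to. -/
def Agree (c : Prog) (s s' : State) : Prop :=
  (∀ a, a ∉ c.natWrites → s'.nat a = s.nat a) ∧ ∀ a, a ∉ c.realWrites → s'.real a = s.real a

lemma Agree.refl (c : Prog) (s : State) : Agree c s s := ⟨fun _ _ => rfl, fun _ _ => rfl⟩

lemma Agree.trans {c : Prog} {s s' s'' : State} (h : Agree c s s') (h' : Agree c s' s'') :
    Agree c s s'' :=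
  ⟨fun a ha => (h'.1 a ha).trans (h.1 a ha), fun a ha => (h'.2 a ha).trans (h.2 a ha)⟩

lemma Agree.mono {c d : Prog} {s s' : State} (h : Agree c s s')
    (hn : ∀ a ∈ c.natWrites, a ∈ d.natWrites) (hr : ∀ a ∈ c.realWrites, a ∈ d.realWrites) :
    Agree d s s' :=
  ⟨fun a ha => h.1 a fun h' => ha (hn a h'), fun a ha => h.2 a fun h' => ha (hr a h')⟩

@[simp] lemma State.setNat_nat (s : State) (a i j x a' i' j' : ℕ) :
    (s.setNat a i j x).nat a' i' j' = if a' = a ∧ i' = i ∧ j' = j then x else s.nat a' i' j' := rfl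

@[simp] lemma State.setNat_real (s : State) (a i j x : ℕ) : (s.setNat a i j x).real = s.real := rfl

@[simp] lemma State.setReal_nat (s : State) (a i j : ℕ) (x : ℝ) :
    (s.setReal a i j x).nat = s.nat := rfl

@[simp] lemma State.setReal_real (s : State) (a i j : ℕ) (x : ℝ) (a' i' j' : ℕ) :
    (s.setReal a i j x).real a' i' j' =
      if a' = a ∧ i' = i ∧ j' = j then x else s.real a' i' j' := rfl

lemma State.setNat_nat_of_ne (s : State) {a a' : ℕ} (h : a' ≠ a) (i j x : ℕ) :
    (s.setNat a i j x).nat a' = s.nat a' := by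
  funext i' j'
  simp [h]

lemma State.setReal_real_of_ne (s : State) {a a' : ℕ} (h : a' ≠ a) (i j : ℕ) (x : ℝ) :
    (s.setReal a i j x).real a' = s.real a' := by
  funext i' j'
  simp [h]

section Runs

variable {n m : ℕ} (v : Profile n m)

lemma Exec.agree {v : Profile n m} {c : Prog} {s s' : State} {t : ℕ} {q : Fin n → ℕ}
    (h : Exec v c s s' t q) : Agree c s s' := by
  induction h with
  | skip s => exact Agree.refl _ _
  | setNat s a i j x =>
    exact ⟨fun a' ha => s.setNat_nat_of_ne (by simpa [Prog.natWrites] using ha) _ _ _,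
      fun _ _ => rfl⟩
  | setReal s a i j x =>
    exact ⟨fun _ _ => rfl,
      fun a' ha => s.setReal_real_of_ne (by simpa [Prog.realWrites] using ha) _ _ _⟩
  | query s a i j player b row k hk =>
    exact ⟨fun _ _ => rfl,
      fun a' ha => s.setReal_real_of_ne (by simpa [Prog.realWrites] using ha) _ _ _⟩
  | seq _ _ ih ih' =>
    refine (ih.mono ?_ ?_).trans (ih'.mono ?_ ?_) <;>
      simp +contextual [Prog.natWrites, Prog.realWrites]
  | iteTrue _ _ ih => refine ih.mono ?_ ?_ <;> simp +contextual [Prog.natWrites, Prog.realWrites]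
  | iteFalse _ _ ih => refine ih.mono ?_ ?_ <;> simp +contextual [Prog.natWrites, Prog.realWrites]
  | whileFalse _ => exact Agree.refl _ _
  | whileTrue _ _ _ ih ih' => exact (ih.mono (fun _ h => h) fun _ h => h).trans ih'

/-- From the state `s` the program `c` halts after at most `T` steps, with at most `Q i` queries to
player `i`, in a state with the property `Post`. -/
def Runs (c : Prog) (s : State) (T : ℕ) (Q : Fin n → ℕ) (Post : State → Prop) : Prop :=
  ∃ s' t q, Exec v c s s' t q ∧ t ≤ T ∧ q ≤ Q ∧ Post s'

variable {v} {c d : Prog} {s : State} {T T' : ℕ} {Q Q' : Fin n → ℕ} {Post Post' : State → Prop}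

lemma Runs.mono (h : Runs v c s T Q Post) (hT : T ≤ T') (hQ : Q ≤ Q')
    (hP : ∀ s', Agree c s s' → Post s' → Post' s') : Runs v c s T' Q' Post' := by
  obtain ⟨s', t, q, he, ht, hq, hp⟩ := h
  exact ⟨s', t, q, he, ht.trans hT, hq.trans hQ, hP s' he.agree hp⟩

/-- The consequence rule, which also records what the program leaves unchanged. -/
lemma Runs.post (h : Runs v c s T Q Post) (hP : ∀ s', Agree c s s' → Post s' → Post' s') :
    Runs v c s T Q Post' :=
  h.mono le_rfl le_rfl hP

lemma Runs.skip (h : Post s) : Runs v .skip s 1 0 Post := ⟨_, _, _, .skip s, le_rfl, le_rfl, h⟩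

lemma Runs.setNat {a : ℕ} {i j x : NExp} (h : Post (s.setNat a (i.eval s) (j.eval s) (x.eval s))) :
    Runs v (.setNat a i j x) s 1 0 Post :=
  ⟨_, _, _, .setNat s a i j x, le_rfl, le_rfl, h⟩

lemma Runs.setReal {a : ℕ} {i j : NExp} {x : RExp}
    (h : Post (s.setReal a (i.eval s) (j.eval s) (x.eval s))) :
    Runs v (.setReal a i j x) s 1 0 Post :=
  ⟨_, _, _, .setReal s a i j x, le_rfl, le_rfl, h⟩

lemma Runs.query {a : ℕ} {i j player : NExp} {b : ℕ} {row : NExp} (k : Fin n)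
    (hk : player.eval s = k)
    (h : Post (s.setReal a (i.eval s) (j.eval s) ((v k).val (s.readBundle m b (row.eval s))))) :
    Runs v (.query a i j player b row) s 1 (Pi.single k 1) Post :=
  ⟨_, _, _, .query s a i j player b row k hk, le_rfl, le_rfl, h⟩

lemma Runs.seq (h : Runs v c s T Q fun s' => Runs v d s' T' Q' Post) :
    Runs v (.seq c d) s (T + T') (Q + Q') Post := by
  obtain ⟨s', t, q, he, ht, hq, s'', t', q', he', ht', hq', hp⟩ := h
  exact ⟨s'', _, _, .seq he he', add_le_add ht ht', add_le_add hq hq', hp⟩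

/-- Sequencing of programs without queries. -/
lemma Runs.seq_zero (h : Runs v c s T 0 fun s' => Runs v d s' T' 0 Post) :
    Runs v (.seq c d) s (T + T') 0 Post := by
  simpa using h.seq

lemma Runs.ite {b : BExp} (ht : b.eval s → Runs v c s T Q Post)
    (hf : ¬ b.eval s → Runs v d s T Q Post) : Runs v (.ite b c d) s (T + 1) Q Post := by
  by_cases hb : b.eval s
  · obtain ⟨s', t, q, he, h1, h2, h3⟩ := ht hb
    exact ⟨s', _, _, .iteTrue hb he, by omega, h2, h3⟩
  · obtain ⟨s', t, q, he, h1, h2, h3⟩ := hf hb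
    exact ⟨s', _, _, .iteFalse hb he, by omega, h2, h3⟩

/-- The content of the cell `(0, 0)` of the array `a`, used as a register. -/
abbrev reg (a : ℕ) : NExp := .get a (.lit 0) (.lit 0)

/-- Assignment to the register `a`. -/
abbrev setReg (a : ℕ) (x : NExp) : Prog := .setNat a (.lit 0) (.lit 0) x

/-- `for a := 0, …, N - 1 do c`, with the register `a` as the counter. -/
def forLoop (a : ℕ) (N : NExp) (c : Prog) : Prog :=
  .seq (setReg a (.lit 0))
    (.while (.natLe (.add (reg a) (.lit 1)) N) (.seq c (setReg a (.add (reg a) (.lit 1)))))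

/-- The rule for `for` loops. The invariant need not mention what the loop leaves unchanged. -/
lemma Runs.forLoop {a : ℕ} {NE : NExp} {N Tb : ℕ} {Qb : ℕ → Fin n → ℕ}
    (Inv : ℕ → State → Prop) (ha : a ∉ c.natWrites)
    (hN : ∀ s', Agree (forLoop a NE c) s s' → NE.eval s' = N)
    (h0 : Inv 0 (s.setNat a 0 0 0))
    (hstep : ∀ k < N, ∀ s', Agree (NashMIR.forLoop a NE c) s s' → s'.nat a 0 0 = k → Inv k s' →
      Runs v c s' Tb (Qb k) fun s'' => Inv (k + 1) (s''.setNat a 0 0 (k + 1))) :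
    Runs v (NashMIR.forLoop a NE c) s (N * (Tb + 2) + 2) (∑ k ∈ Finset.range N, Qb k) (Inv N) := by
  set L := NashMIR.forLoop a NE c with hL
  have hset : ∀ s' x, Agree L s' (s'.setNat a 0 0 x) := fun s' x =>
    ⟨fun a' ha' => s'.setNat_nat_of_ne (by
      rintro rfl
      exact ha' (by simp [hL, NashMIR.forLoop, Prog.natWrites])) _ _ _, fun _ _ => rfl⟩
  have hbody : ∀ s' s'', Agree c s' s'' → Agree L s' s'' := fun s' s'' h =>
    h.mono (fun a h => by simp [hL, NashMIR.forLoop, Prog.natWrites, h])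
      (fun a h => by simp [hL, NashMIR.forLoop, Prog.realWrites, h])
  have main : ∀ r k, k + r = N → ∀ s', Agree L s s' → s'.nat a 0 0 = k → Inv k s' →
      Runs v (.while (.natLe (.add (reg a) (.lit 1)) NE)
        (.seq c (setReg a (.add (reg a) (.lit 1))))) s' (r * (Tb + 2) + 1)
        (∑ j ∈ Finset.Ico k N, Qb j) (Inv N) := by
    intro r
    induction r with
    | zero =>
      intro k hk s' hs hc hi
      refine ⟨s', _, _, .whileFalse ?_, by omega, by simp, ?_⟩
      · simp only [BExp.eval, NExp.eval, hc, hN s' hs]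
        omega
      · rwa [← hk]
    | succ r ih =>
      intro k hk s' hs hc hi
      obtain ⟨s₁, t₁, q₁, he, ht, hq, hp⟩ := hstep k (by omega) s' hs hc hi
      have hc1 : s₁.nat a 0 0 = k := by rw [he.agree.1 a ha, hc]
      have he2 := Exec.seq he (Exec.setNat (v := v) s₁ a (.lit 0) (.lit 0) (.add (reg a) (.lit 1)))
      simp only [NExp.eval, hc1] at he2
      obtain ⟨s₂, t₂, q₂, he', ht', hq', hp'⟩ := ih (k + 1) (by omega) _
        ((hs.trans (hbody _ _ he.agree)).trans (hset s₁ (k + 1))) (by simp) hp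
      refine ⟨s₂, _, _, .whileTrue ?_ he2 he', ?_, ?_, hp'⟩
      · simp only [BExp.eval, NExp.eval, hc, hN s' hs]
        omega
      · have : (r + 1) * (Tb + 2) = r * (Tb + 2) + (Tb + 2) := by ring
        omega
      · rw [Finset.sum_eq_sum_Ico_succ_bot (by omega), add_zero]
        exact add_le_add hq hq'
  obtain ⟨s', t, q, he, ht, hq, hp⟩ := main N 0 (by omega) _ (hset s 0) (by simp) h0
  refine ⟨s', _, _, .seq (.setNat s a (.lit 0) (.lit 0) (.lit 0)) he, by omega, ?_, hp⟩
  rw [zero_add, Finset.range_eq_Ico]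
  exact hq

/-- The rule for `for` loops whose body makes no queries. -/
lemma Runs.forLoop_zero {a : ℕ} {NE : NExp} {N Tb : ℕ}
    (Inv : ℕ → State → Prop) (ha : a ∉ c.natWrites)
    (hN : ∀ s', Agree (NashMIR.forLoop a NE c) s s' → NE.eval s' = N)
    (h0 : Inv 0 (s.setNat a 0 0 0))
    (hstep : ∀ k < N, ∀ s', Agree (NashMIR.forLoop a NE c) s s' → s'.nat a 0 0 = k → Inv k s' →
      Runs v c s' Tb 0 fun s'' => Inv (k + 1) (s''.setNat a 0 0 (k + 1))) :
    Runs v (NashMIR.forLoop a NE c) s (N * (Tb + 2) + 2) 0 (Inv N) := by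
  simpa using Runs.forLoop (Qb := fun _ => 0) Inv ha hN h0 hstep

end Runs

/-! ### The program -/

/-!
The arrays of natural numbers are used as follows: row `t` of array `4` is the indicator of the
object `t`; row `0` of `5` holds the binary digits of the code `B` of the reserved bundles; row `U`
of `6` is the matching kept for the set of players coded by `U`, and row `0` of `7` the best
complete matching found. Registers: `10` and `11` hold `2 ^ n` and `2 ^ (2 * n)`, `12` holds `B`, `16`
the object `t`, `15` the set `U`, `13` and `14` hold `U / 2 ^ i` and `2 ^ i`, `21` tells whether `t` is
available, and `17`, …, `20` are counters. The arrays of real numbers are: `1`, the values of the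
objects; `2`, the weights of the matchings in array `6`; `3`, the weight of the best complete matching;
`4` and `5`, two products.
-/

/-- `2n`. -/
abbrev twoN : NExp := .add (reg 0) (reg 0)

/-- The last set of players in binary code, that is, all players. -/
abbrev fullSet : NExp := .sub (reg 10) (.lit 1)

/-- Writes the indicators of all objects to array `4`. -/
def buildObjects : Prog :=
  forLoop 18 (reg 1)
    (.seq (.setNat 4 (.get 2 (.lit 0) (reg 18)) (reg 18) (.lit 1))
    (.seq (.setNat 4 (.add twoN (reg 18)) (reg 18) (.lit 1))
    (.setNat 4 (.add twoN (reg 1)) (reg 18) (.lit 1))))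

/-- Asks every player for the values of all objects. -/
def queryValues : Prog :=
  forLoop 18 (.add (.add twoN (reg 1)) (.lit 1))
    (forLoop 19 (reg 0) (.query 1 (reg 19) (reg 18) (reg 19) 4 (reg 18)))

/-- Computes `2 ^ n` and `2 ^ (2 * n)`. -/
def powers : Prog :=
  .seq (setReg 10 (.lit 1)) (.seq (forLoop 18 (reg 0) (setReg 10 (.add (reg 10) (reg 10))))
  (.seq (setReg 11 (.lit 1)) (forLoop 18 twoN (setReg 11 (.add (reg 11) (reg 11))))))

/-- Computes the binary digits of `B`. -/
def binaryDigits : Prog :=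
  .seq (setReg 13 (reg 12))
  (forLoop 18 twoN
    (.seq (.setNat 5 (.lit 0) (reg 18) (.sub (reg 13) (.add (.half (reg 13)) (.half (reg 13)))))
    (setReg 13 (.half (reg 13)))))

/-- Initializes the table for no objects: only the empty set of players can be matched. A matching
that does not exist has weight `0`, and the array `6` need not be reset. -/
def resetTable : Prog :=
  .seq (forLoop 18 (reg 10) (.setReal 2 (reg 18) (.lit 0) .zero))
  (.setReal 2 (.lit 0) (.lit 0) .one)

/-- The set `U` without the player `i`. -/
abbrev withoutPlayer : NExp := .sub (reg 15) (reg 14)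

/-- The weight of the best matching of `U \ {i}`, extended by giving the object `t` to `i`. -/
abbrev candidate : RExp :=
  .mul (.get 2 withoutPlayer (.lit 0)) (.get 1 (reg 19) (reg 16))

/-- Replaces the matching of `U` by the candidate. -/
def replaceEntry : Prog :=
  .seq (.setReal 2 (reg 15) (.lit 0) candidate)
  (.seq (forLoop 20 (reg 0) (.setNat 6 (reg 15) (reg 20) (.get 6 withoutPlayer (reg 20))))
  (.setNat 6 (reg 15) (reg 19) (reg 16)))

/-- Compares the candidate with the entry of `U` if the player `i` belongs to `U`. -/
def tryPlayer : Prog :=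
  .seq (.ite (.and (.natLe (.lit 1) (.sub (reg 13) (.add (.half (reg 13)) (.half (reg 13)))))
      (.not (.realLe candidate (.get 2 (reg 15) (.lit 0)))))
    replaceEntry .skip)
  (.seq (setReg 13 (.half (reg 13))) (setReg 14 (.add (reg 14) (reg 14))))

/-- Updates the entry of `U` for the object `t`. -/
def updateEntry : Prog :=
  .seq (setReg 15 (.sub fullSet (reg 17)))
  (.seq (setReg 13 (reg 15)) (.seq (setReg 14 (.lit 1)) (forLoop 19 (reg 0) tryPlayer)))

/-- The sets `U` are processed in decreasing order, so that the entries of smaller sets still refer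
to the earlier objects. -/
def updateTable : Prog := forLoop 17 (reg 10) updateEntry

/-- Bundles are available if reserved, items if their bundle is not reserved. -/
def checkAvailable : Prog :=
  .ite (.natLe (.add (reg 16) (.lit 1)) twoN) (setReg 21 (.get 5 (.lit 0) (reg 16)))
    (setReg 21 (.sub (.lit 1) (.get 5 (.lit 0) (.get 2 (.lit 0) (.sub (reg 16) twoN)))))

/-- Extends the table by the object `t`. -/
def processObject : Prog :=
  .seq checkAvailable (.ite (.natLe (.lit 1) (reg 21)) updateTable .skip)

/-- Fills the table for all objects except the bundle of all items. -/
def processObjects : Prog := forLoop 16 (.add twoN (reg 1)) processObject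

/-- Compares the best matching of all players with the best complete matching found before. -/
def recordBest : Prog :=
  .ite (.not (.realLe (.get 2 fullSet (.lit 0)) (.get 3 (.lit 0) (.lit 0))))
    (.seq (.setReal 3 (.lit 0) (.lit 0) (.get 2 fullSet (.lit 0)))
      (forLoop 18 (reg 0) (.setNat 7 (.lit 0) (reg 18) (.get 6 fullSet (reg 18)))))
    .skip

/-- Finds the best matching for the reserved bundles coded by `B`. -/
def tryReserved : Prog :=
  .seq binaryDigits (.seq resetTable (.seq processObjects recordBest))

/-- Tries all sets of reserved bundles. -/
def search : Prog := forLoop 12 (reg 11) tryReserved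

/-- Outputs the bundles of the best complete matching. -/
def writeBundles : Prog :=
  forLoop 18 (reg 0) (forLoop 19 (reg 1)
    (.setNat 3 (reg 18) (reg 19) (.get 4 (.get 7 (.lit 0) (reg 18)) (reg 19))))

/-- Multiplies the values of the players other than the one in register `18`, for their own bundles
and for all items. -/
def multiplyOthers : Prog :=
  forLoop 19 (reg 0)
    (.ite (.and (.natLe (reg 18) (reg 19)) (.natLe (reg 19) (reg 18))) .skip
      (.seq (.setReal 4 (.lit 0) (.lit 0)
        (.mul (.get 4 (.lit 0) (.lit 0)) (.get 1 (reg 19) (.get 7 (.lit 0) (reg 19)))))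
      (.setReal 5 (.lit 0) (.lit 0)
        (.mul (.get 5 (.lit 0) (.lit 0)) (.get 1 (reg 19) (.add twoN (reg 1)))))))

/-- Outputs the fees `fee`. -/
def writeFees : Prog :=
  forLoop 18 (reg 0)
    (.seq (.setReal 4 (.lit 0) (.lit 0) .one) (.seq (.setReal 5 (.lit 0) (.lit 0) .one)
    (.seq multiplyOthers
    (.setReal 0 (reg 18) (.lit 0)
      (.sub .one (.div (.get 4 (.lit 0) (.lit 0)) (.get 5 (.lit 0) (.lit 0))))))))

/-- If the best welfare is `0`, the output arrays keep their initial zeros: the null allocation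
without fees. -/
def writeOutput : Prog :=
  .ite (.not (.realLe (.get 3 (.lit 0) (.lit 0)) .zero)) (.seq writeBundles writeFees) .skip

/-- The mechanism, with its fees. -/
def mechanism : Prog :=
  .seq buildObjects (.seq queryValues (.seq powers (.seq search writeOutput)))

/-! ### Correctness of the program -/

/-- The input is in place. -/
structure HasInput {n m : ℕ} (π : Fin m → Fin (2 * n)) (s : State) : Prop where
  players : s.nat 0 0 0 = n
  items : s.nat 1 0 0 = m
  parts : ∀ j : Fin m, s.nat 2 0 j = π j

/-- The input and the results of the preparations are in place. -/
structure Prepared {n m : ℕ} (v : Profile n m) (π : Fin m → Fin (2 * n)) (s : State) : Prop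
    extends HasInput π s where
  objects : ∀ (t : ℕ) (x : Fin m), s.nat 4 t x ≠ 0 ↔ x ∈ object π t
  values : ∀ i < n, ∀ t ≤ 2 * n + m, s.real 1 i t = objectValue v π i t
  pow : s.nat 10 0 0 = 2 ^ n
  pow' : s.nat 11 0 0 = 2 ^ (2 * n)

section Correctness

variable {n m : ℕ} {v : Profile n m} {π : Fin m → Fin (2 * n)} {s s' : State} {c : Prog}

lemma HasInput.agree (h : HasInput π s) (ha : Agree c s s')
    (hc : ∀ a ∈ [0, 1, 2], a ∉ c.natWrites) : HasInput π s' := by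
  simp only [List.forall_mem_cons, List.not_mem_nil, false_implies, implies_true, and_true] at hc
  exact ⟨by rw [ha.1 _ hc.1, h.players], by rw [ha.1 _ hc.2.1, h.items],
    fun j => by rw [ha.1 _ hc.2.2, h.parts]⟩

lemma Prepared.agree (h : Prepared v π s) (ha : Agree c s s')
    (hc : ∀ a ∈ [0, 1, 2, 4, 10, 11], a ∉ c.natWrites) (hc' : 1 ∉ c.realWrites) :
    Prepared v π s' := by
  simp only [List.forall_mem_cons, List.not_mem_nil, false_implies, implies_true, and_true] at hc
  obtain ⟨h0, h1, h2, h4, h10, h11⟩ := hc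
  exact ⟨⟨by rw [ha.1 _ h0, h.players], by rw [ha.1 _ h1, h.items],
    fun j => by rw [ha.1 _ h2, h.parts]⟩, by rw [ha.1 _ h4]; exact h.objects,
    by rw [ha.2 _ hc']; exact h.values, by rw [ha.1 _ h10, h.pow], by rw [ha.1 _ h11, h.pow']⟩

lemma buildObjects_runs (h : HasInput π s) (h4 : ∀ t x, s.nat 4 t x = 0) :
    Runs v buildObjects s (m * ((1 + (1 + 1)) + 2) + 2) 0 fun s' =>
      ∀ (t : ℕ) (x : Fin m), s'.nat 4 t x ≠ 0 ↔ x ∈ object π t := by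
  refine (Runs.forLoop_zero (N := m) (fun k s' => ∀ (t : ℕ) (x : Fin m),
    s'.nat 4 t x ≠ 0 ↔ (x : ℕ) < k ∧ x ∈ object π t) (by decide)
    (fun s' ha => by simp [NExp.eval, (h.agree ha (by decide)).items]) ?_ ?_).post
    fun s' _ hs' t x => by rw [hs']; simp
  · simp [h4]
  · intro k hk s' ha hc hi
    have h' := h.agree ha (by decide)
    refine Runs.seq_zero (Runs.setNat (Runs.seq_zero (Runs.setNat (Runs.setNat ?_))))
    intro t x
    have hp : s'.nat 2 0 k = π ⟨k, hk⟩ := h'.parts ⟨k, hk⟩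
    have hix := hi t x
    simp only [NExp.eval, State.setNat_nat, hc, h'.players, h'.items, hp]
    norm_num
    simp only [object, Finset.mem_filter, Finset.mem_univ, true_and] at hix ⊢
    by_cases hxk : (x : ℕ) = k
    · obtain rfl : x = ⟨k, hk⟩ := Fin.ext hxk
      simp only [two_mul] at hix ⊢
      simp only [and_true]
      split_ifs <;> simp_all
    · simp only [hxk, and_false, if_false]
      have : (x : ℕ) ≤ k ↔ (x : ℕ) < k := by omega
      rw [this]
      exact hix

lemma queryValues_runs (h : HasInput π s)
    (h4 : ∀ (t : ℕ) (x : Fin m), s.nat 4 t x ≠ 0 ↔ x ∈ object π t) :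
    Runs v queryValues s ((2 * n + m + 1) * ((n * (1 + 2) + 2) + 2) + 2)
      (fun _ => 2 * n + m + 1) fun s' =>
      ∀ i < n, ∀ t ≤ 2 * n + m, s'.real 1 i t = objectValue v π i t := by
  refine (Runs.forLoop (N := 2 * n + m + 1) (Qb := fun _ => ∑ k ∈ Finset.range n,
      if hk : k < n then Pi.single ⟨k, hk⟩ 1 else 0)
    (fun k s' => ∀ i < n, ∀ t < k, s'.real 1 i t = objectValue v π i t) (by decide)
    (fun s' ha => ?_) (by simp) ?_).mono le_rfl ?_ fun s' _ hs' i hi t ht =>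
      hs' i hi t (Nat.lt_succ_of_le ht)
  · have h' := h.agree ha (by decide)
    simp only [NExp.eval, h'.players, h'.items]
    omega
  · intro k hk s' ha hc hi
    have h' := h.agree ha (by decide)
    have hb : s'.readBundle m 4 k = object π k := by
      ext x
      rw [State.readBundle, Finset.mem_filter, ha.1 4 (by decide), h4]
      simp
    refine (Runs.forLoop (N := n) (Qb := fun k => if hk : k < n then Pi.single ⟨k, hk⟩ 1 else 0)
      (fun l s'' => (∀ i < n, ∀ t < k, s''.real 1 i t = objectValue v π i t) ∧
        ∀ i < l, s''.real 1 i k = objectValue v π i k) (by decide)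
      (fun s'' ha' => by simp [NExp.eval, (h'.agree ha' (by decide)).players]) ?_ ?_).post ?_
    · exact ⟨hi, by simp⟩
    · intro l hl s'' ha' hc' hi'
      have hc2 : s''.nat 18 0 0 = k := by rw [ha'.1 18 (by decide), hc]
      rw [dif_pos hl]
      refine Runs.query ⟨l, hl⟩ (by simp [NExp.eval, hc']) ?_
      have hb' : s''.readBundle m 4 k = object π k := by
        rw [← hb]
        simp only [State.readBundle, ha'.1 4 (by decide)]
      simp only [NExp.eval, State.setReal_real, State.setNat_real, hc', hc2, hb']
      refine ⟨fun i hin t ht => ?_, fun i hil => ?_⟩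
      · rw [if_neg (by omega)]
        exact hi'.1 i hin t ht
      · rcases (Nat.lt_succ_iff.1 hil).eq_or_lt with rfl | hlt
        · simp [objectValue, hl]
        · rw [if_neg (by omega)]
          exact hi'.2 i hlt
    · intro s'' _ hs'' i hin t ht
      simp only [State.setNat_real]
      rcases (Nat.lt_succ_iff.1 ht).eq_or_lt with rfl | hlt
      · exact hs''.2 i hin
      · exact hs''.1 i hin t hlt
  · intro i
    have h1 : (∑ k ∈ Finset.range n, if hk : k < n then Pi.single ⟨k, hk⟩ 1 else 0 : Fin n → ℕ) i
        = 1 := by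
      rw [Finset.sum_apply, Finset.sum_eq_single (i : ℕ)]
      · simp
      · intro k hk hne
        rw [dif_pos (Finset.mem_range.1 hk), Pi.single_eq_of_ne]
        exact fun e => hne (congrArg Fin.val e).symm
      · simp
    rw [Finset.sum_apply, Finset.sum_congr rfl fun _ _ => h1]
    simp

lemma powers_runs (h : HasInput π s) :
    Runs v powers s (1 + ((n * (1 + 2) + 2) + (1 + (2 * n * (1 + 2) + 2)))) 0 fun s' =>
      s'.nat 10 0 0 = 2 ^ n ∧ s'.nat 11 0 0 = 2 ^ (2 * n) := by
  refine Runs.seq_zero (Runs.setNat (Runs.seq_zero ((Runs.forLoop_zero (N := n)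
    (fun k s' => s'.nat 10 0 0 = 2 ^ k) (by decide) (fun s' ha => ?_) ?_ ?_).post ?_)))
  · rw [NExp.eval, ha.1 _ (by decide)]
    simpa [NExp.eval] using h.players
  · simp [NExp.eval]
  · intro k hk s' ha hc hi
    refine Runs.setNat ?_
    simp [NExp.eval, hi, pow_succ, mul_two]
  · intro s₁ ha₁ h₁
    have hn1 : s₁.nat 0 0 0 = n := by
      rw [ha₁.1 _ (by decide)]
      simpa [NExp.eval] using h.players
    refine Runs.seq_zero (Runs.setNat ((Runs.forLoop_zero (N := 2 * n)
      (fun k s' => s'.nat 11 0 0 = 2 ^ k) (by decide) (fun s' ha => ?_) ?_ ?_).post ?_))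
    · simp only [NExp.eval]
      rw [ha.1 _ (by decide)]
      simp [NExp.eval, hn1, two_mul]
    · simp [NExp.eval]
    · intro k hk s' ha hc hi
      refine Runs.setNat ?_
      simp [NExp.eval, hi, pow_succ, mul_two]
    · intro s₂ ha₂ h₂
      refine ⟨?_, h₂⟩
      rw [ha₂.1 _ (by decide)]
      simpa [NExp.eval] using h₁

lemma binaryDigits_runs {B : ℕ} (h : Prepared v π s) (hB : s.nat 12 0 0 = B) :
    Runs v binaryDigits s (1 + (2 * n * ((1 + 1) + 2) + 2)) 0 fun s' =>
      ∀ k < 2 * n, s'.nat 5 0 k = if B.testBit k = true then 1 else 0 := by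
  refine Runs.seq_zero (Runs.setNat ((Runs.forLoop_zero (N := 2 * n)
    (fun k s' => s'.nat 13 0 0 = B / 2 ^ k ∧
      ∀ l < k, s'.nat 5 0 l = if B.testBit l = true then 1 else 0) (by decide)
    (fun s' ha => ?_) ?_ ?_).post fun s' _ hs' => hs'.2))
  · simp only [NExp.eval]
    rw [ha.1 _ (by decide)]
    simp [NExp.eval, h.players, two_mul]
  · simp [NExp.eval, hB]
  · intro k hk s' ha hc hi
    refine Runs.seq_zero (Runs.setNat (Runs.setNat ?_))
    simp only [NExp.eval, State.setNat_nat, hc, hi.1]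
    norm_num
    refine ⟨?_, fun l hl => ?_⟩
    · rw [Nat.div_div_eq_div_mul, pow_succ]
    · rcases hl.eq_or_lt with rfl | hlt
      · rw [if_pos rfl, Nat.testBit_eq_decide_div_mod_eq]
        simp only [decide_eq_true_eq]
        split_ifs <;> omega
      · rw [if_neg hlt.ne]
        exact hi.2 l hlt

lemma resetTable_runs (h : Prepared v π s) :
    Runs v resetTable s ((2 ^ n * (1 + 2) + 2) + 1) 0 fun s' =>
      ∀ U < 2 ^ n, s'.real 2 U 0 = if U = 0 then 1 else 0 := by
  refine Runs.seq_zero ((Runs.forLoop_zero (N := 2 ^ n)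
    (fun k s' => ∀ U < k, s'.real 2 U 0 = 0) (by decide)
    (fun s' ha => by simp [NExp.eval, (h.agree ha (by decide) (by decide)).pow]) (by simp) ?_).post
    fun s' _ hs' => Runs.setReal ?_)
  · intro k hk s' ha hc hi
    refine Runs.setReal ?_
    intro U hU
    simp only [NExp.eval, RExp.eval, State.setReal_real, State.setNat_real, hc]
    by_cases hUk : U = k
    · simp [hUk]
    · rw [if_neg (by omega)]
      exact hi U (by omega)
  · intro U hU
    simp only [NExp.eval, RExp.eval, State.setReal_real]
    by_cases hU0 : U = 0
    · simp [hU0]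
    · simp [hU0, hs' U hU]

lemma replaceEntry_runs {U p i t : ℕ} (h : Prepared v π s) (hU : s.nat 15 0 0 = U)
    (hp : s.nat 14 0 0 = p) (hi : s.nat 19 0 0 = i) (ht : s.nat 16 0 0 = t) (hne : U - p ≠ U) :
    Runs v replaceEntry s (1 + ((n * (1 + 2) + 2) + 1)) 0 fun s' =>
      s'.real 2 U 0 = s.real 2 (U - p) 0 * s.real 1 i t ∧
      (∀ l < n, s'.nat 6 U l = if l = i then t else s.nat 6 (U - p) l) ∧
      ∀ U' ≠ U, s'.real 2 U' 0 = s.real 2 U' 0 ∧ s'.nat 6 U' = s.nat 6 U' := by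
  refine Runs.seq_zero (Runs.setReal (Runs.seq_zero ((Runs.forLoop_zero (N := n)
    (fun k s' => (∀ l < k, s'.nat 6 U l = s.nat 6 (U - p) l) ∧
      ∀ U' ≠ U, s'.nat 6 U' = s.nat 6 U') (by decide) (fun s' ha => ?_) ?_ ?_).post ?_)))
  · simp only [NExp.eval]
    rw [ha.1 _ (by decide)]
    exact h.players
  · refine ⟨by simp, fun U' _ => ?_⟩
    rw [State.setNat_nat_of_ne _ (by decide), State.setReal_nat]
  · intro k hk s' ha hc hinv
    have hU' : s'.nat 15 0 0 = U := by rw [ha.1 _ (by decide)]; exact hU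
    have hp' : s'.nat 14 0 0 = p := by rw [ha.1 _ (by decide)]; exact hp
    refine Runs.setNat ⟨fun l hl => ?_, fun U' hne' => ?_⟩
    · simp only [NExp.eval, State.setNat_nat, hc, hU', hp', hinv.2 _ hne]
      norm_num
      split_ifs with hlk
      · rw [hlk]
      · exact hinv.1 l (by omega)
    · rw [State.setNat_nat_of_ne _ (by decide), ← hinv.2 U' hne']
      funext l
      simp [NExp.eval, hU', hne']
  · intro s' ha hinv
    have hU' : s'.nat 15 0 0 = U := by rw [ha.1 _ (by decide)]; exact hU
    have hi' : s'.nat 19 0 0 = i := by rw [ha.1 _ (by decide)]; exact hi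
    have ht' : s'.nat 16 0 0 = t := by rw [ha.1 _ (by decide)]; exact ht
    refine Runs.setNat ⟨?_, fun l hl => ?_, fun U' hne' => ⟨?_, ?_⟩⟩
    · rw [State.setNat_real, ha.2 _ (by decide)]
      simp [NExp.eval, RExp.eval, hU, hp, hi, ht]
    · simp [NExp.eval, hU', hi', ht', hinv.1 l hl]
    · rw [State.setNat_real, ha.2 _ (by decide)]
      simp [NExp.eval, hU, hne']
    · rw [← hinv.2 U' hne']
      funext l
      simp [NExp.eval, hU', hne']

/-- The table entry of `U` in a state. -/
def EntryAt (v : Profile n m) (π : Fin m → Fin (2 * n)) (B t U : ℕ) (s : State) : Prop :=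
  TableEntry n (Available π B) (objectValue v π) t U (s.real 2 U 0) (s.nat 6 U)

lemma updateEntry_runs {B t u : ℕ} (h : Prepared v π s)
    (hc : s.nat 17 0 0 = u) (ht : s.nat 16 0 0 = t) (htm : t < 2 * n + m) (hav : Available π B t)
    (hE : ∀ U ≤ 2 ^ n - 1 - u, EntryAt v π B t U s) :
    Runs v updateEntry s
      (1 + (1 + (1 + (n * ((((1 + ((n * (1 + 2) + 2) + 1)) + 1) + (1 + 1)) + 2) + 2)))) 0 fun s' =>
      EntryAt v π B (t + 1) (2 ^ n - 1 - u) s' ∧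
      ∀ U' ≠ 2 ^ n - 1 - u, s'.real 2 U' 0 = s.real 2 U' 0 ∧ s'.nat 6 U' = s.nat 6 U' := by
  set U := 2 ^ n - 1 - u with hU
  refine Runs.seq_zero (Runs.setNat (Runs.seq_zero (Runs.setNat (Runs.seq_zero (Runs.setNat ?_)))))
  set s₀ := ((s.setNat 15 ((NExp.lit 0).eval s) ((NExp.lit 0).eval s)
    ((NExp.sub fullSet (reg 17)).eval s)).setNat 13 _ _ _).setNat 14 _ _ _ with hs₀
  have ha₀ : Agree updateEntry s s₀ := by
    refine ⟨fun a ha => ?_, fun a _ => rfl⟩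
    have h15 : a ≠ 15 := by rintro rfl; exact ha (by decide)
    have h13 : a ≠ 13 := by rintro rfl; exact ha (by decide)
    have h14 : a ≠ 14 := by rintro rfl; exact ha (by decide)
    rw [hs₀, State.setNat_nat_of_ne _ h14, State.setNat_nat_of_ne _ h13,
      State.setNat_nat_of_ne _ h15]
  have h15 : s₀.nat 15 0 0 = U := by
    simp [hs₀, NExp.eval, h.pow, hc, hU]
  have h13 : s₀.nat 13 0 0 = U := by
    simp [hs₀, NExp.eval, h.pow, hc, hU]
  have h14 : s₀.nat 14 0 0 = 1 := by
    simp [hs₀, NExp.eval]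
  have h6 : s₀.nat 6 = s.nat 6 := by
    rw [hs₀, State.setNat_nat_of_ne _ (by decide), State.setNat_nat_of_ne _ (by decide),
      State.setNat_nat_of_ne _ (by decide)]
  have h2 : s₀.real = s.real := rfl
  have h16 : s₀.nat 16 0 0 = t := by simp [hs₀, ht]
  have hp₀ : Prepared v π s₀ := h.agree ha₀ (by decide) (by decide)
  clear_value s₀
  refine (Runs.forLoop_zero (N := n) (fun i s' => s'.nat 13 0 0 = U / 2 ^ i ∧
    s'.nat 14 0 0 = 2 ^ i ∧
    PartialEntry n (Available π B) (objectValue v π) t U i (s'.real 2 U 0) (s'.nat 6 U) ∧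
    ∀ U' ≠ U, s'.real 2 U' 0 = s.real 2 U' 0 ∧ s'.nat 6 U' = s.nat 6 U') (by decide)
    (fun s' ha => by simp [NExp.eval, (hp₀.agree ha (by decide) (by decide)).players]) ?_ ?_).post ?_
  · refine ⟨by simp [h13], by simp [h14], ?_, fun U' _ => ?_⟩
    · rw [State.setNat_real, State.setNat_nat_of_ne _ (by decide), h2, h6]
      exact (hE U le_rfl).partialEntry_zero
    · rw [State.setNat_real, State.setNat_nat_of_ne _ (by decide), h2, h6]
      exact ⟨rfl, rfl⟩
  · rintro i hi s' ha hci ⟨i13, i14, iP, iO⟩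
    have hp' := hp₀.agree ha (by decide) (by decide)
    have h15' : s'.nat 15 0 0 = U := by rw [ha.1 _ (by decide), h15]
    have h16' : s'.nat 16 0 0 = t := by rw [ha.1 _ (by decide), h16]
    have hval : s'.real 1 i t = objectValue v π i t := hp'.values i hi t htm.le
    have hw := objectValue_nonneg v π i t
    have hsmaller : U.testBit i = true → U - 2 ^ i < U := fun hb => by
      have := Nat.ge_two_pow_of_testBit hb
      have := Nat.two_pow_pos i
      omega
    have hentry : U.testBit i = true → EntryAt v π B t (U - 2 ^ i) s' := fun hb => by
      have hlt := hsmaller hb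
      have := hE (U - 2 ^ i) hlt.le
      rw [EntryAt] at this ⊢
      rwa [(iO _ hlt.ne).1, (iO _ hlt.ne).2]
    have hbit : (1 ≤ U / 2 ^ i - (U / 2 ^ i / 2 + U / 2 ^ i / 2)) ↔ U.testBit i = true := by
      rw [Nat.testBit_eq_decide_div_mod_eq, decide_eq_true_eq]
      omega
    have hcond : (BExp.and (.natLe (.lit 1) (.sub (reg 13) (.add (.half (reg 13)) (.half (reg 13)))))
      (.not (.realLe candidate (.get 2 (reg 15) (.lit 0))))).eval s' ↔
        U.testBit i = true ∧ s'.real 2 U 0 < s'.real 2 (U - 2 ^ i) 0 * objectValue v π i t := by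
      simp only [BExp.eval, NExp.eval, RExp.eval, i13, i14, h15', hci, h16', hval, hbit, not_le]
    refine Runs.seq_zero (T := (1 + ((n * (1 + 2) + 2) + 1)) + 1) (T' := 1 + 1)
      (Runs.post (Post := fun s'' =>
      PartialEntry n (Available π B) (objectValue v π) t U (i + 1) (s''.real 2 U 0) (s''.nat 6 U) ∧
      ∀ U' ≠ U, s''.real 2 U' 0 = s.real 2 U' 0 ∧ s''.nat 6 U' = s.nat 6 U')
      (Runs.ite (T := 1 + ((n * (1 + 2) + 2) + 1)) (fun hb => ?_) fun hb => ?_) ?_)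
    · rw [hcond] at hb
      obtain ⟨hb, hlt⟩ := hb
      refine (replaceEntry_runs hp' h15' i14 hci h16' (hsmaller hb).ne).post ?_
      rintro s'' - ⟨r1, r2, r3⟩
      refine ⟨?_, fun U' hne => ?_⟩
      · rw [r1, hval]
        exact iP.succ_of_lt hw hi hb hav (hentry hb) hlt (by simp [r2 i hi])
          fun l hl hne => by simp [r2 l hl, hne]
      · rw [(r3 U' hne).1, (r3 U' hne).2]
        exact iO U' hne
    · rw [hcond, not_and, not_lt] at hb
      refine Runs.mono (Runs.skip (Post := fun s'' => s'' = s') rfl) (by omega) le_rfl ?_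
      rintro s'' - rfl
      refine ⟨?_, iO⟩
      by_cases hbi : U.testBit i = true
      · exact iP.succ_of_le hw hi hbi (hentry hbi) (hb hbi)
      · exact iP.succ_of_bit_false (by simpa using hbi)
    · rintro s'' ha'' ⟨r1, r2⟩
      have e13 : s''.nat 13 0 0 = U / 2 ^ i := by rw [ha''.1 _ (by decide), i13]
      have e14 : s''.nat 14 0 0 = 2 ^ i := by rw [ha''.1 _ (by decide), i14]
      refine Runs.seq_zero (Runs.setNat (Runs.setNat ⟨?_, ?_, ?_, ?_⟩))
      · simp [NExp.eval, e13, Nat.div_div_eq_div_mul, pow_succ]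
      · simp [NExp.eval, e14, pow_succ, mul_two]
      · rw [State.setNat_nat_of_ne _ (by decide), State.setNat_nat_of_ne _ (by decide),
          State.setNat_nat_of_ne _ (by decide)]
        exact r1
      · rw [State.setNat_nat_of_ne _ (by decide), State.setNat_nat_of_ne _ (by decide),
          State.setNat_nat_of_ne _ (by decide)]
        exact r2
  · rintro s' - ⟨-, -, iP, iO⟩
    exact ⟨iP.tableEntry, iO⟩

lemma updateTable_runs {B t : ℕ} (h : Prepared v π s) (ht : s.nat 16 0 0 = t)
    (htm : t < 2 * n + m) (hav : Available π B t) (hE : ∀ U < 2 ^ n, EntryAt v π B t U s) :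
    Runs v updateTable s (2 ^ n * ((3 * n ^ 2 + 9 * n + 5) + 2) + 2) 0 fun s' =>
      ∀ U < 2 ^ n, EntryAt v π B (t + 1) U s' := by
  refine (Runs.forLoop_zero (N := 2 ^ n) (fun u s' => ∀ U < 2 ^ n,
    (2 ^ n ≤ U + u → EntryAt v π B (t + 1) U s') ∧ (U + u < 2 ^ n → EntryAt v π B t U s'))
    (by decide) (fun s' ha => by simp [NExp.eval, (h.agree ha (by decide) (by decide)).pow])
    ?_ ?_).post fun s' _ hs' U hU => (hs' U hU).1 (by omega)
  · refine fun U hU => ⟨fun h => by omega, fun _ => ?_⟩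
    rw [EntryAt, State.setNat_nat_of_ne _ (by decide), State.setNat_real]
    exact hE U hU
  · intro u hu s' ha hc hi
    have ht' : s'.nat 16 0 0 = t := by rw [ha.1 _ (by decide), ht]
    refine (updateEntry_runs (h.agree ha (by decide) (by decide)) hc ht' htm hav
      fun U hU => (hi U (by omega)).2 (by omega)).mono (by ring_nf; omega) le_rfl ?_
    rintro s'' - ⟨h1, h2⟩ U hU
    rw [EntryAt, EntryAt, State.setNat_nat_of_ne _ (by decide), State.setNat_real]
    by_cases hUu : U = 2 ^ n - 1 - u
    · subst hUu
      exact ⟨fun _ => h1, fun h => by omega⟩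
    · rw [(h2 U hUu).1, (h2 U hUu).2]
      exact ⟨fun h => (hi U hU).1 (by omega), fun h => (hi U hU).2 (by omega)⟩

lemma checkAvailable_runs {B t : ℕ} (h : HasInput π s) (ht : s.nat 16 0 0 = t)
    (htm : t < 2 * n + m)
    (h5 : ∀ k < 2 * n, s.nat 5 0 k = if B.testBit k = true then 1 else 0) :
    Runs v checkAvailable s (1 + 1) 0 fun s' => 1 ≤ s'.nat 21 0 0 ↔ Available π B t := by
  refine Runs.ite (fun hb => Runs.setNat ?_) fun hb => Runs.setNat ?_
  · have hlt : t < 2 * n := by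
      simp only [BExp.eval, NExp.eval, h.players, ht] at hb
      omega
    simp only [NExp.eval, State.setNat_nat, ht, h5 t hlt, Available]
    norm_num
    constructor
    · intro hp
      refine ⟨fun _ => ?_, fun j hj => by omega⟩
      by_contra hbit
      simp [hbit] at hp
    · intro hp
      simp [hp.1 hlt]
  · have hge : 2 * n ≤ t := by
      simp only [BExp.eval, NExp.eval, h.players, ht] at hb
      omega
    have e : s.nat 2 0 (t - (n + n)) = π ⟨t - 2 * n, by omega⟩ := by
      rw [show t - (n + n) = t - 2 * n by omega]
      exact h.parts ⟨t - 2 * n, by omega⟩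
    simp only [NExp.eval, State.setNat_nat, h.players, ht, e, h5 _ (Fin.is_lt _), Available]
    norm_num
    constructor
    · intro hp
      refine ⟨fun h => by omega, fun j hj => ?_⟩
      have hj' : (⟨t - 2 * n, by omega⟩ : Fin m) = j := Fin.ext (by simp; omega)
      rw [hj'] at hp
      cases hbit : B.testBit (π j)
      · rfl
      · simp [hbit] at hp
    · intro hp
      have := hp.2 ⟨t - 2 * n, by omega⟩ (by simp; omega)
      simp [this]

lemma processObjects_runs {B : ℕ} (h : Prepared v π s)
    (h5 : ∀ k < 2 * n, s.nat 5 0 k = if B.testBit k = true then 1 else 0)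
    (hE : ∀ U < 2 ^ n, EntryAt v π B 0 U s) :
    Runs v processObjects s
      ((2 * n + m) * (((1 + 1) + ((2 ^ n * ((3 * n ^ 2 + 9 * n + 5) + 2) + 2) + 1)) + 2) + 2) 0
      fun s' => ∀ U < 2 ^ n, EntryAt v π B (2 * n + m) U s' := by
  refine Runs.forLoop_zero (N := 2 * n + m) (fun t s' => ∀ U < 2 ^ n, EntryAt v π B t U s')
    (by decide) (fun s' ha => ?_) ?_ ?_
  · have h' := h.agree ha (by decide) (by decide)
    simp only [NExp.eval, h'.players, h'.items, two_mul]
  · intro U hU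
    rw [EntryAt, State.setNat_nat_of_ne _ (by decide), State.setNat_real]
    exact hE U hU
  · intro t ht s' ha hc hi
    have h' := h.agree ha (by decide) (by decide)
    refine Runs.seq_zero ((checkAvailable_runs h'.toHasInput hc ht
      (by rw [ha.1 _ (by decide)]; exact h5)).post fun s₁ ha₁ h₁ => ?_)
    have h₁' := h'.agree ha₁ (by decide) (by decide)
    have hi₁ : ∀ U < 2 ^ n, EntryAt v π B t U s₁ := fun U hU => by
      rw [EntryAt, ha₁.1 _ (by decide), ha₁.2 _ (by decide)]
      exact hi U hU
    have key : ∀ s₂ : State, (∀ U < 2 ^ n, EntryAt v π B (t + 1) U s₂) →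
        ∀ U < 2 ^ n, EntryAt v π B (t + 1) U (s₂.setNat 16 0 0 (t + 1)) := fun s₂ h₂ U hU => by
      rw [EntryAt, State.setNat_nat_of_ne _ (by decide), State.setNat_real]
      exact h₂ U hU
    refine Runs.ite (fun hb => ?_) fun hb => ?_
    · exact (updateTable_runs h₁' (by rw [ha₁.1 _ (by decide), hc]) ht (h₁.1 hb) hi₁).post
        fun s₂ _ h₂ => key s₂ h₂
    · refine Runs.mono (Runs.skip (Post := fun s₂ => s₂ = s₁) rfl) (by omega) le_rfl ?_
      rintro s₂ - rfl
      exact key _ fun U hU => (hi₁ U hU).succ_of_not_av fun hav => hb (h₁.2 hav)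

/-- The best complete matching over all sets of reserved bundles with a code below `k` has been
recorded. -/
def BestAt (v : Profile n m) (π : Fin m → Fin (2 * n)) (k : ℕ) (s : State) : Prop :=
  IsBest n (objectValue v π) (2 ^ n - 1)
    (fun τ => ∃ B < k, Feasible n (Available π B) (2 * n + m) (2 ^ n - 1) τ)
    (fun τ => ∃ B, Feasible n (Available π B) (2 * n + m) (2 ^ n - 1) τ)
    (s.real 3 0 0) (s.nat 7 0)

lemma recordBest_runs {B : ℕ} (h : Prepared v π s)
    (hE : EntryAt v π B (2 * n + m) (2 ^ n - 1) s) (hbest : BestAt v π B s) :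
    Runs v recordBest s ((1 + (n * (1 + 2) + 2)) + 1) 0 fun s' => BestAt v π (B + 1) s' := by
  refine Runs.ite (fun hb => ?_) fun hb => ?_
  · simp only [BExp.eval, NExp.eval, RExp.eval, h.pow, not_le] at hb
    refine Runs.seq_zero (Runs.setReal ((Runs.forLoop_zero (N := n)
      (fun k s' => ∀ l < k, s'.nat 7 0 l = s.nat 6 (2 ^ n - 1) l) (by decide)
      (fun s' ha => ?_) (by simp) ?_).post ?_))
    · simp only [NExp.eval]
      rw [ha.1 _ (by decide)]
      exact h.players
    · intro k hk s' ha hc hi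
      have h10 : s'.nat 10 0 0 = 2 ^ n := by rw [ha.1 _ (by decide)]; exact h.pow
      have h6 : s'.nat 6 = s.nat 6 := by rw [ha.1 _ (by decide), State.setReal_nat]
      refine Runs.setNat fun l hl => ?_
      simp only [NExp.eval, State.setNat_nat, hc, h10, h6]
      norm_num
      split_ifs with hlk
      · rw [hlk]
      · exact hi l (by omega)
    · intro s' ha hi
      have h3 : s'.real 3 0 0 = s.real 2 (2 ^ n - 1) 0 := by
        rw [ha.2 _ (by decide)]
        simp [NExp.eval, RExp.eval, h.pow]
      rw [BestAt, h3]
      refine ⟨hE.nonneg, fun h0 => ⟨⟨B, (hE.attained h0).1.congr hi⟩,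
        (matchWeight_congr hi).trans (hE.attained h0).2⟩, ?_⟩
      rintro τ ⟨B', hB', hτ⟩
      rcases (Nat.lt_succ_iff.1 hB').eq_or_lt with rfl | hlt
      · exact hE.upper τ hτ
      · exact (hbest.upper τ ⟨B', hlt, hτ⟩).trans hb.le
  · simp only [BExp.eval, NExp.eval, RExp.eval, h.pow, not_le, not_lt] at hb
    refine Runs.mono (Runs.skip (Post := fun s' => s' = s) rfl) (by omega) le_rfl ?_
    rintro s' - rfl
    refine ⟨hbest.nonneg, hbest.attained, ?_⟩
    rintro τ ⟨B', hB', hτ⟩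
    rcases (Nat.lt_succ_iff.1 hB').eq_or_lt with rfl | hlt
    · exact (hE.upper τ hτ).trans hb
    · exact hbest.upper τ ⟨B', hlt, hτ⟩

/-- A bound on the steps for one set of reserved bundles. -/
def reservedSteps (n m : ℕ) : ℕ :=
  (1 + (2 * n * ((1 + 1) + 2) + 2)) + (((2 ^ n * (1 + 2) + 2) + 1) +
    (((2 * n + m) * (((1 + 1) + ((2 ^ n * ((3 * n ^ 2 + 9 * n + 5) + 2) + 2) + 1)) + 2) + 2) +
      ((1 + (n * (1 + 2) + 2)) + 1)))

lemma search_runs (h : Prepared v π s) (h3 : s.real 3 0 0 = 0) :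
    Runs v search s (2 ^ (2 * n) * (reservedSteps n m + 2) + 2) 0
      fun s' => BestAt v π (2 ^ (2 * n)) s' := by
  refine Runs.forLoop_zero (N := 2 ^ (2 * n)) (BestAt v π)
    (by decide) (fun s' ha => (h.agree ha (by decide) (by decide)).pow') ?_ ?_
  · rw [BestAt, State.setNat_real, h3]
    exact ⟨le_rfl, fun h => absurd h (lt_irrefl _), fun τ ⟨B, hB, _⟩ => absurd hB (Nat.not_lt_zero _)⟩
  · intro B hB s' ha hc hi
    have h' := h.agree ha (by decide) (by decide)
    refine Runs.seq_zero ((binaryDigits_runs h' hc).post fun s₁ ha₁ h₁ => ?_)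
    have h₁' := h'.agree ha₁ (by decide) (by decide)
    refine Runs.seq_zero ((resetTable_runs h₁').post fun s₂ ha₂ h₂ => ?_)
    have h₂' := h₁'.agree ha₂ (by decide) (by decide)
    refine Runs.seq_zero ((processObjects_runs (B := B) h₂'
      (by rw [ha₂.1 _ (by decide)]; exact h₁) fun U hU => ?_).post fun s₃ ha₃ h₃ => ?_)
    · rw [EntryAt, h₂ U hU]
      exact tableEntry_zero hU
    have h₃' := h₂'.agree ha₃ (by decide) (by decide)
    refine (recordBest_runs h₃' (h₃ _ (Nat.sub_lt (Nat.two_pow_pos n) one_pos)) ?_).post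
      fun s₄ _ h₄ => ?_
    · rw [BestAt, ha₃.1 _ (by decide), ha₂.1 _ (by decide), ha₁.1 _ (by decide),
        ha₃.2 _ (by decide), ha₂.2 _ (by decide), ha₁.2 _ (by decide)]
      exact hi
    · rw [BestAt, State.setNat_nat_of_ne _ (by decide), State.setNat_real]
      exact h₄

lemma writeBundles_runs (h : Prepared v π s) :
    Runs v writeBundles s (n * ((m * (1 + 2) + 2) + 2) + 2) 0
      fun s' => ∀ i < n, ∀ x < m, s'.nat 3 i x = s.nat 4 (s.nat 7 0 i) x := by
  refine Runs.forLoop_zero (N := n)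
    (fun k s' => ∀ i < k, ∀ x < m, s'.nat 3 i x = s.nat 4 (s.nat 7 0 i) x) (by decide)
    (fun s' ha => (h.agree ha (by decide) (by decide)).players) (by simp) ?_
  intro k hk s' ha hc hi
  have h' := h.agree ha (by decide) (by decide)
  refine (Runs.forLoop_zero (N := m) (fun y s'' =>
    (∀ i < k, ∀ x < m, s''.nat 3 i x = s.nat 4 (s.nat 7 0 i) x) ∧
      ∀ x < y, s''.nat 3 k x = s.nat 4 (s.nat 7 0 k) x) (by decide)
    (NE := reg 1) (fun s'' ha' => (h'.agree ha' (by decide) (by decide)).items) ?_ ?_).post ?_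
  · refine ⟨?_, by simp⟩
    rw [State.setNat_nat_of_ne _ (by decide)]
    exact hi
  · intro y hy s'' ha' hc' hi'
    have h18 : s''.nat 18 0 0 = k := by rw [ha'.1 _ (by decide), hc]
    have h4 : s''.nat 4 = s.nat 4 := by rw [ha'.1 _ (by decide), ha.1 _ (by decide)]
    have h7 : s''.nat 7 = s.nat 7 := by rw [ha'.1 _ (by decide), ha.1 _ (by decide)]
    refine Runs.setNat ?_
    rw [State.setNat_nat_of_ne _ (by decide)]
    simp only [NExp.eval, State.setNat_nat, h18, hc', h4, h7]
    refine ⟨fun i hik x hx => ?_, fun x hx => ?_⟩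
    · rw [if_neg (by omega)]
      exact hi'.1 i hik x hx
    · rcases (Nat.lt_succ_iff.1 hx).eq_or_lt with rfl | hlt
      · simp
      · rw [if_neg (by omega)]
        exact hi'.2 x hlt
  · intro s'' _ hs'' i hik x hx
    rw [State.setNat_nat_of_ne _ (by decide)]
    rcases (Nat.lt_succ_iff.1 hik).eq_or_lt with rfl | hlt
    · exact hs''.2 x hx
    · exact hs''.1 i hlt x hx

lemma multiplyOthers_runs {i : ℕ} (h : Prepared v π s) (h18 : s.nat 18 0 0 = i)
    (h4 : s.real 4 0 0 = 1) (h5 : s.real 5 0 0 = 1) (h7 : ∀ l < n, s.nat 7 0 l < 2 * n + m) :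
    Runs v multiplyOthers s (n * (((1 + 1) + 1) + 2) + 2) 0 fun s' =>
      s'.real 4 0 0 = ∏ k ∈ (Finset.range n).erase i, objectValue v π k (s.nat 7 0 k) ∧
      s'.real 5 0 0 = ∏ k ∈ (Finset.range n).erase i, objectValue v π k (2 * n + m) := by
  refine Runs.forLoop_zero (N := n) (fun l s' =>
      s'.real 4 0 0 = ∏ k ∈ (Finset.range l).erase i, objectValue v π k (s.nat 7 0 k) ∧
      s'.real 5 0 0 = ∏ k ∈ (Finset.range l).erase i, objectValue v π k (2 * n + m)) (by decide)
    (fun s' ha => (h.agree ha (by decide) (by decide)).players) (by simp [h4, h5]) ?_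
  intro l hl s' ha hc hi
  have h' := h.agree ha (by decide) (by decide)
  have h18' : s'.nat 18 0 0 = i := by rw [ha.1 _ (by decide), h18]
  have h7' : s'.nat 7 = s.nat 7 := ha.1 _ (by decide)
  refine Runs.ite (fun hb => ?_) fun hb => ?_
  · simp only [BExp.eval, NExp.eval, h18', hc] at hb
    obtain rfl : i = l := le_antisymm hb.1 hb.2
    refine Runs.mono (Runs.skip (Post := fun s'' => s'' = s') rfl) (by omega) le_rfl ?_
    rintro s'' - rfl
    rw [State.setNat_real, Finset.range_add_one, Finset.erase_insert (by simp)]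
    rwa [Finset.erase_eq_of_notMem (by simp)] at hi
  · simp only [BExp.eval, NExp.eval, h18', hc] at hb
    have hne : l ≠ i := fun e => hb ⟨e.symm.le, e.le⟩
    refine Runs.seq_zero (Runs.setReal (Runs.setReal ?_))
    have hnot : l ∉ (Finset.range l).erase i := by simp
    rw [State.setNat_real, Finset.range_add_one, Finset.erase_insert_of_ne hne,
      Finset.prod_insert hnot, Finset.prod_insert hnot, ← hi.1, ← hi.2]
    have e2 : n + n + m = 2 * n + m := by omega
    simp only [NExp.eval, RExp.eval, State.setReal_real, State.setReal_nat, hc, h'.players,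
      h'.items, h7', e2]
    norm_num
    rw [h'.values l hl _ (h7 l hl).le, h'.values l hl _ le_rfl]
    exact ⟨mul_comm _ _, mul_comm _ _⟩

lemma writeFees_runs (h : Prepared v π s) (h7 : ∀ l < n, s.nat 7 0 l < 2 * n + m) :
    Runs v writeFees s (n * ((1 + (1 + ((n * (((1 + 1) + 1) + 2) + 2) + 1))) + 2) + 2) 0 fun s' =>
      ∀ i < n, s'.real 0 i 0 =
        1 - (∏ k ∈ (Finset.range n).erase i, objectValue v π k (s.nat 7 0 k)) /
          ∏ k ∈ (Finset.range n).erase i, objectValue v π k (2 * n + m) := by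
  refine Runs.forLoop_zero (N := n) (fun l s' => ∀ i < l, s'.real 0 i 0 =
        1 - (∏ k ∈ (Finset.range n).erase i, objectValue v π k (s.nat 7 0 k)) /
          ∏ k ∈ (Finset.range n).erase i, objectValue v π k (2 * n + m)) (by decide)
    (fun s' ha => (h.agree ha (by decide) (by decide)).players) (by simp) ?_
  intro l hl s' ha hc hi
  have h' := h.agree ha (by decide) (by decide)
  have h7' : s'.nat 7 = s.nat 7 := ha.1 _ (by decide)
  refine Runs.seq_zero (Runs.setReal (Runs.seq_zero (Runs.setReal (Runs.seq_zero ?_))))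
  set s₀ := (s'.setReal 4 _ _ _).setReal 5 _ _ _ with hs₀
  have hp₀ : Prepared v π s₀ :=
    ⟨⟨h'.players, h'.items, h'.parts⟩, h'.objects, by
      rw [hs₀, State.setReal_real_of_ne _ (by decide), State.setReal_real_of_ne _ (by decide)]
      exact h'.values, h'.pow, h'.pow'⟩
  have h0 : s₀.real 0 = s'.real 0 := by
    rw [hs₀, State.setReal_real_of_ne _ (by decide), State.setReal_real_of_ne _ (by decide)]
  have hn : s₀.nat = s'.nat := rfl
  refine (multiplyOthers_runs (i := l) hp₀ (by rw [hn, hc])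
    (by simp [hs₀, NExp.eval, RExp.eval]) (by simp [hs₀, NExp.eval, RExp.eval])
    (by rw [hn, h7']; exact h7)).post fun s₁ ha₁ h₁ => Runs.setReal ?_
  rw [hn, h7'] at h₁
  have hc₁ : s₁.nat 18 0 0 = l := by rw [ha₁.1 _ (by decide), hn, hc]
  intro i hil
  simp only [NExp.eval, RExp.eval, State.setReal_real, State.setNat_real, hc₁, h₁.1, h₁.2]
  rcases (Nat.lt_succ_iff.1 hil).eq_or_lt with rfl | hlt
  · simp
  · rw [if_neg (by omega), ha₁.2 _ (by decide), h0]
    exact hi i hlt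

/-- What the mechanism has to output for the profile `v`. -/
def CorrectOutput (v : Profile n m) (π : Fin m → Fin (2 * n)) (A : Assignment n m)
    (p : Fin n → ℝ) : Prop :=
  ((∃ A' ∈ bundleRange π, 0 < nsw v A') →
    A ∈ bundleRange π ∧ ∀ A' ∈ bundleRange π, nsw v A' ≤ nsw v A) ∧
  ((¬ ∃ A' ∈ bundleRange π, 0 < nsw v A') → A = fun _ => ∅) ∧ p = fee v A

lemma matchWeight_objectValue (v : Profile n m) (π : Fin m → Fin (2 * n)) (σ : ℕ → ℕ) :
    matchWeight n (objectValue v π) (2 ^ n - 1) σ = ∏ i : Fin n, (v i).val (object π (σ i)) := by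
  rw [matchWeight, Finset.prod_range]
  refine Finset.prod_congr rfl fun i _ => ?_
  simp [objectValue]

lemma prod_range_erase_objectValue (v : Profile n m) (π : Fin m → Fin (2 * n)) (σ : ℕ → ℕ)
    (i : Fin n) :
    ∏ k ∈ (Finset.range n).erase i, objectValue v π k (σ k) =
      ∏ k ∈ Finset.univ.erase i, (v k).val (object π (σ k)) := by
  symm
  refine Finset.prod_bij (fun k _ => (k : ℕ)) (fun k hk => ?_) (fun _ _ _ _ => Fin.ext)
    (fun k hk => ?_) fun k hk => by simp [objectValue]
  · simpa [Fin.ext_iff] using hk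
  · rw [Finset.mem_erase, Finset.mem_range] at hk
    exact ⟨⟨k, hk.2⟩, by simpa [Fin.ext_iff] using hk.1, rfl⟩

/-- The weight recorded by the search bounds the welfare of every allocation in the range. -/
lemma BestAt.prod_le (h : BestAt v π (2 ^ (2 * n)) s) {A : Assignment n m}
    (hA : A ∈ bundleRange π) : ∏ i, (v i).val (A i) ≤ s.real 3 0 0 := by
  by_cases hpos : 0 < ∏ i, (v i).val (A i)
  swap
  · exact (not_lt.1 hpos).trans h.nonneg
  have hne : ∀ i, (A i).Nonempty := fun i => Finset.nonempty_iff_ne_empty.2 fun h0 =>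
    hpos.ne' (Finset.prod_eq_zero (Finset.mem_univ i) (by rw [h0, (v i).empty]))
  obtain ⟨B, hB, σ, hσ, hAσ⟩ := exists_feasible_of_mem_bundleRange π hA hne
  have := h.upper σ ⟨B, hB, hσ⟩
  rw [matchWeight_objectValue] at this
  rwa [Finset.prod_congr rfl fun i _ => by rw [hAσ i]]

/-- A bound on the steps of the output phase. -/
def outputSteps (n m : ℕ) : ℕ :=
  ((n * ((m * (1 + 2) + 2) + 2) + 2) +
    (n * ((1 + (1 + ((n * (((1 + 1) + 1) + 2) + 2) + 1))) + 2) + 2)) + 1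

lemma writeOutput_runs (hn : 1 ≤ n) (h : Prepared v π s) (hbest : BestAt v π (2 ^ (2 * n)) s)
    (h3 : ∀ i x, s.nat 3 i x = 0) (h0 : ∀ i, s.real 0 i 0 = 0) :
    Runs v writeOutput s (outputSteps n m) 0 fun s' =>
      CorrectOutput v π (s'.outAssignment n m) (s'.outFee n) := by
  have hub := fun (A : Assignment n m) (hA : A ∈ bundleRange π) => hbest.prod_le hA
  refine Runs.ite (fun hb => ?_) fun hb => ?_
  · simp only [BExp.eval, NExp.eval, RExp.eval, not_le] at hb
    obtain ⟨⟨B, hB⟩, hw⟩ := hbest.attained hb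
    have h7 : ∀ l < n, s.nat 7 0 l < 2 * n + m := fun l hl => (hB.1 l hl (by simp [hl])).1
    have hA := mem_bundleRange_of_feasible π hB
    set A : Assignment n m := fun i => object π (s.nat 7 0 i) with hAdef
    rw [matchWeight_objectValue] at hw
    refine Runs.seq_zero ((writeBundles_runs h).post fun s₁ ha₁ h₁ => ?_)
    have h₁' := h.agree ha₁ (by decide) (by decide)
    have h7' : s₁.nat 7 = s.nat 7 := ha₁.1 _ (by decide)
    refine (writeFees_runs h₁' (by rw [h7']; exact h7)).post fun s₂ ha₂ h₂ => ?_
    rw [h7'] at h₂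
    have hout : s₂.outAssignment n m = A := by
      funext i
      ext x
      rw [State.outAssignment, State.readBundle, Finset.mem_filter, ha₂.1 _ (by decide),
        h₁ i i.2 x x.2, h.objects]
      simp [hAdef]
    have hApos : 0 < ∏ k, (v k).val (A k) := by rw [hw]; exact hb
    rw [hout]
    refine ⟨fun _ => ⟨hA, fun A' hA' => (nsw_le_nsw_iff hn v A' A).2 ((hub A' hA').trans hw.ge)⟩,
      fun hex => absurd ⟨A, hA, (nsw_pos_iff hn v A).2 hApos⟩ hex, ?_⟩
    funext i
    rw [State.outFee, h₂ i i.2, fee, if_pos hApos, prod_range_erase_objectValue,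
      prod_range_erase_objectValue v π (fun _ => 2 * n + m), object_univ]
  · simp only [BExp.eval, NExp.eval, RExp.eval, not_le, not_lt] at hb
    refine Runs.mono (Runs.skip (Post := fun s' => s' = s) rfl) (by omega) le_rfl ?_
    rintro s' - rfl
    have hout : s'.outAssignment n m = fun _ => ∅ := by
      funext i
      ext x
      simp [State.outAssignment, State.readBundle, h3]
    have hz : ¬ 0 < ∏ k : Fin n, (v k).val (∅ : Finset (Fin m)) := by
      rw [Finset.prod_eq_zero (Finset.mem_univ ⟨0, hn⟩) (v _).empty]
      exact lt_irrefl _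
    rw [hout]
    refine ⟨fun ⟨A', hA', hpos⟩ => ?_, fun _ => rfl, ?_⟩
    · exact absurd ((nsw_pos_iff hn v A').1 hpos) (not_lt.2 ((hub A' hA').trans hb))
    · funext i
      rw [State.outFee, h0, fee, if_neg hz]

/-- A bound on all steps. -/
def mechanismSteps (n m : ℕ) : ℕ :=
  (m * ((1 + (1 + 1)) + 2) + 2) + (((2 * n + m + 1) * ((n * (1 + 2) + 2) + 2) + 2) +
    ((1 + ((n * (1 + 2) + 2) + (1 + (2 * n * (1 + 2) + 2)))) +
      ((2 ^ (2 * n) * (reservedSteps n m + 2) + 2) + outputSteps n m)))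

theorem mechanism_runs (hn : 1 ≤ n) (v : Profile n m) (π : Fin m → Fin (2 * n)) :
    Runs v mechanism (initState π) (mechanismSteps n m) (fun _ => 2 * n + m + 1) fun s' =>
      CorrectOutput v π (s'.outAssignment n m) (s'.outFee n) := by
  have h : HasInput π (initState π) :=
    ⟨by simp [initState], by simp [initState], fun j => by simp [initState]⟩
  have hzero : ∀ a, 3 ≤ a → ∀ i j, (initState π).nat a i j = 0 := fun a ha i j => by
    simp only [initState]
    rw [if_neg (by omega), if_neg (by omega), dif_neg (by omega)]
  have hreal : ∀ a, (initState π).real a = fun _ _ => 0 := fun a => rfl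
  have hQ : (0 : Fin n → ℕ) + ((fun _ => 2 * n + m + 1) + 0) = fun _ => 2 * n + m + 1 := by simp
  rw [← hQ]
  refine Runs.seq ((buildObjects_runs h (hzero 4 (by omega))).post fun s₁ ha₁ h₁ => ?_)
  have hi₁ := h.agree ha₁ (by decide)
  refine Runs.seq ((queryValues_runs hi₁ h₁).post fun s₂ ha₂ h₂ => ?_)
  have hi₂ := hi₁.agree ha₂ (by decide)
  refine Runs.seq_zero ((powers_runs hi₂).post fun s₃ ha₃ h₃ => ?_)
  have hp₃ : Prepared v π s₃ := ⟨hi₂.agree ha₃ (by decide),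
    by rw [ha₃.1 _ (by decide), ha₂.1 _ (by decide)]; exact h₁,
    by rw [ha₃.2 _ (by decide)]; exact h₂, h₃.1, h₃.2⟩
  refine Runs.seq_zero ((search_runs hp₃ ?_).post fun s₄ ha₄ h₄ => ?_)
  · rw [ha₃.2 _ (by decide), ha₂.2 _ (by decide), ha₁.2 _ (by decide), hreal]
  refine writeOutput_runs hn (hp₃.agree ha₄ (by decide) (by decide)) h₄ ?_ ?_
  · rw [ha₄.1 _ (by decide), ha₃.1 _ (by decide), ha₂.1 _ (by decide), ha₁.1 _ (by decide)]
    exact hzero 3 le_rfl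
  · rw [ha₄.2 _ (by decide), ha₃.2 _ (by decide), ha₂.2 _ (by decide), ha₁.2 _ (by decide), hreal]
    exact fun _ => rfl

end Correctness

/-! ### Counting steps -/

/-- All quantities in the step count are bounded by powers of `Z = 2 ^ n * m`. -/
lemma mechanismSteps_le {n m : ℕ} (hm : 1 ≤ m) :
    mechanismSteps n m ≤ 300 * 2 ^ (300 * n) * m ^ 300 := by
  set Z := 2 ^ n * m with hZ
  have hX : 1 ≤ 2 ^ n := Nat.one_le_two_pow
  have hZ1 : 1 ≤ Z := Nat.mul_pos hX hm
  have hXZ : 2 ^ n ≤ Z := Nat.le_mul_of_pos_right _ hm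
  have hmZ : m ≤ Z := Nat.le_mul_of_pos_left _ hX
  have hnZ : n ≤ Z := Nat.lt_two_pow_self.le.trans hXZ
  have hX2 : 2 ^ (2 * n) ≤ Z ^ 2 := by
    rw [mul_comm, pow_mul]
    exact Nat.pow_le_pow_left hXZ 2
  have hpow : ∀ a ≤ 6, Z ^ a ≤ Z ^ 6 := fun a ha => Nat.pow_le_pow_right hZ1 ha
  have h0 := hpow 0 (by omega)
  have h1 := hpow 1 (by omega)
  have h2 := hpow 2 (by omega)
  have h3 := hpow 3 (by omega)
  have h4 := hpow 4 (by omega)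
  have h5 := hpow 5 (by omega)
  have hbound : mechanismSteps n m ≤ 300 * Z ^ 6 := by
    have hle : mechanismSteps n m ≤ (Z * ((1 + (1 + 1)) + 2) + 2) +
        (((2 * Z + Z + 1) * ((Z * (1 + 2) + 2) + 2) + 2) +
        ((1 + ((Z * (1 + 2) + 2) + (1 + (2 * Z * (1 + 2) + 2)))) +
        ((Z ^ 2 * (((1 + (2 * Z * ((1 + 1) + 2) + 2)) + (((Z * (1 + 2) + 2) + 1) +
          (((2 * Z + Z) * (((1 + 1) + ((Z * ((3 * Z ^ 2 + 9 * Z + 5) + 2) + 2) + 1)) + 2) + 2) +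
          ((1 + (Z * (1 + 2) + 2)) + 1)))) + 2) + 2) +
        (((Z * ((Z * (1 + 2) + 2) + 2) + 2) +
          (Z * ((1 + (1 + ((Z * (((1 + 1) + 1) + 2) + 2) + 1))) + 2) + 2)) + 1)))) := by
      unfold mechanismSteps reservedSteps outputSteps
      gcongr
    refine hle.trans ?_
    ring_nf at h0 h1 h2 h3 h4 h5 ⊢
    linarith
  refine hbound.trans ?_
  rw [hZ, mul_pow, ← pow_mul, mul_comm n 6, ← mul_assoc]
  gcongr <;> norm_num

theorem exists_implementation :
    ∃ (P : Prog) (K : ℕ), ∀ n m : ℕ, 1 ≤ n → 1 ≤ m →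
      ∃ (f : (Fin m → Fin (2 * n)) → Profile n m → Assignment n m)
        (p : (Fin m → Fin (2 * n)) → Profile n m → Fin n → ℝ),
        (∀ π, IsMaximalInRange (bundleRange π) (f π) ∧ IsIncentiveCompatible (f π) (p π)) ∧
        ∀ (π : Fin m → Fin (2 * n)) (v : Profile n m),
          ∃ (s : State) (t : ℕ) (q : Fin n → ℕ),
            Exec v P (initState π) s t q ∧
            s.outAssignment n m = f π v ∧ s.outFee n = p π v ∧
            (∀ i, q i ≤ K * (m + n)) ∧
            t ≤ K * 2 ^ (K * n) * m ^ K := by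
  refine ⟨mechanism, 300, fun n m hn hm => ?_⟩
  choose out t q hexec ht hq hcorrect using fun (π : Fin m → Fin (2 * n)) (v : Profile n m) =>
    mechanism_runs hn v π
  have hmax : ∀ π, IsMaximalInRange (bundleRange π) fun v => (out π v).outAssignment n m :=
    fun π v => ⟨(hcorrect π v).1, (hcorrect π v).2.1⟩
  refine ⟨fun π v => (out π v).outAssignment n m, fun π v => (out π v).outFee n,
    fun π => ⟨hmax π, ?_⟩, fun π v => ⟨out π v, t π v, q π v, hexec π v, rfl, rfl, fun i => ?_,
      (ht π v).trans (mechanismSteps_le hm)⟩⟩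
  · have h : (fun v => (out π v).outFee n) = fun v => fee v ((out π v).outAssignment n m) :=
      funext fun v => (hcorrect π v).2.2
    dsimp only
    rw [h]
    exact isIncentiveCompatible_fee hn (hmax π)
  · have := hq π v i
    dsimp only at this
    omega

end NashMIR

open NashMIR
theorem mainTheorem7 :
    -- incentive compatibility, for every realization of the partition
    (∀ n m : ℕ, 1 ≤ n → 1 ≤ m → ∀ (π : Fin m → Fin (2 * n))
      (f : Profile n m → Assignment n m), IsMaximalInRange (bundleRange π) f →
        ∃ p : Profile n m → Fin n → ℝ, IsIncentiveCompatible f p) ∧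
    -- approximation ratio, with high probability over the partition
    (∃ C C' : ℝ, 0 < C ∧ 0 < C' ∧ ∀ n m : ℕ, 1 ≤ n → 1 ≤ m →
      (∀ f : (Fin m → Fin (2 * n)) → Profile n m → Assignment n m,
        (∀ π, IsMaximalInRange (bundleRange π) (f π)) →
        ∀ v : Profile n m, (∀ i, (v i).Subadditive) →
          1 - 1 / (m : ℝ) ≤ (partitionLaw n m).real
            {π | ApproximatesNSW
              (min ((m : ℝ) / n) (C * (n * Real.log m ^ 2))) v (f π v)}) ∧
      min ((m : ℝ) / n) (C * (n * Real.log m ^ 2)) ≤ C' * (Real.sqrt m * Real.log m)) ∧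
    -- implementation: allocation and fees, numbers of queries and steps
    (∃ (P : Prog) (K : ℕ), ∀ n m : ℕ, 1 ≤ n → 1 ≤ m →
      ∃ (f : (Fin m → Fin (2 * n)) → Profile n m → Assignment n m)
        (p : (Fin m → Fin (2 * n)) → Profile n m → Fin n → ℝ),
        (∀ π, IsMaximalInRange (bundleRange π) (f π) ∧ IsIncentiveCompatible (f π) (p π)) ∧
        ∀ (π : Fin m → Fin (2 * n)) (v : Profile n m),
          ∃ (s : State) (t : ℕ) (q : Fin n → ℕ),
            Exec v P (initState π) s t q ∧
            s.outAssignment n m = f π v ∧ s.outFee n = p π v ∧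
            (∀ i, q i ≤ K * (m + n)) ∧
            t ≤ K * 2 ^ (K * n) * m ^ K) := by
  refine ⟨fun n m hn _ π f hf => ⟨_, isIncentiveCompatible_fee hn hf⟩,
    ⟨64, 8, by norm_num, by norm_num, fun n m hn hm =>
      ⟨fun f hf v hv => approximation hn hm hf v hv, min_ratio_le hn⟩⟩, exists_implementation⟩
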